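/- **Setting.** A distribution $F$ of nonnegative values, with $F(v)=\Pr_{x\sim F}[x<v]$, is assumed to have a density $f$ strictly below the supremum of its support (an atom at that supremum is allowed), with $f>0$ strictly between the infimum and the supremum of the support. For $\lambda\in[0,1]$, $F$ is *$\lambda$-regular* if $\lambda v-\frac{1-F(v)}{f(v)}$ is non-decreasing there, *regular* if $v-\frac{1-F(v)}{f(v)}$ is non-decreasing there, and *MHR* if $\frac{f(v)}{1-F(v)}$ is non-decreasing there; $\mathcal F_{(\lambda\text{-Reg})}$, $\mathcal F_{\mathrm{Reg}}$, $\mathcal F_{\mathrm{MHR}}$ are the classes of such distributions. For $m$ identical units and $N$ unit-demand buyers with i.i.d. values from $F$, $\mathrm{RevVCG}_{m:N}(F)$ is the expected revenue of the VCG auction, which gives a unit to each of the $m$ highest-value buyers at a price equal to the $(m+1)$-th highest value ($0$ if there is none), and $\mathrm{RevOPT}_{m:N}(F)$ is the Bayesian-optimal revenue, i.e. the supremum of the expected revenue over all feasible mechanisms (nonnegative payments, at most $m$ units allocated) that are Bayesian incentive compatible and interim individually rational. For a class $\mathcal F$, $m\le n$ and $\Gamma\in(0,1)$ let $$\mathrm{CC}(m,n,\mathcal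 F,\Gamma)=\min\{k\in\mathbb N:\ \forall F\in\mathcal F,\ \mathrm{RevVCG}_{m:n+k}(F)\ge\Gamma\cdot\mathrm{RevOPT}_{m:n}(F)\}$$ ($0\in\mathbb N$; the value is $\infty$ if no such $k$ exists), and let $\mathrm{CC}_{(\infty)}(\alpha,\mathcal F,\Gamma)=\lim_{n\to\infty}\mathrm{CC}(\lceil\alpha n\rceil,n,\mathcal F,\Gamma)/n$. **Theorem.** Let $\alpha\in(0,1]$, $\Gamma\in(0,1)$, and write $[x]_+=\max\{x,0\}$. The limits below exist and, for every $\lambda\in(0,1]$ (with $0^0=1$), $$\mathrm{CC}_{(\infty)}(\alpha,\mathcal F_{(\lambda\text{-Reg})},\Gamma)=\Big[\alpha\Big(\tfrac{\lambda\Gamma}{\alpha}(1-\lambda)^{\frac{1-\lambda}{\lambda}}+1\Big)^{1/\lambda}-1\Big]_+\cdot\mathbf 1\{\alpha\ge(1-\lambda)^{1/\lambda}\}.$$ For $\lambda=0$ the formula is read as its limit as $\lambda\to0$: both for $\mathcal F=\mathcal F_{(0\text{-Reg})}$ and for $\mathcal F=\mathcal F_{\mathrm{MHR}}$, $$\mathrm{CC}_{(\infty)}(\alpha,\mathcal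 F,\Gamma)=\big[\alpha e^{\Gamma/(e\alpha)}-1\big]_+\cdot\mathbf 1\{\alpha\ge 1/e\}.$$ For regular distributions, $\mathrm{CC}_{(\infty)}(\alpha,\mathcal F_{\mathrm{Reg}},\Gamma)=[\Gamma+\alpha-1]_+$. All of this stays true if each class is intersected with an arbitrary collection $\mathcal D$ of distributions that contains every distribution which has a Lebesgue density (hence no atom) and for which some price $p$ in the support maximizes $p(1-F(p))$. -/

import Mathlib

open MeasureTheory Filter Topology
open scoped ENNReal

noncomputable section

namespace Auction

/-! ### Value distributions -/

/-- `1 - F(v)`, where `F(v) = Pr[x < v]` is the (left-continuous) CDF of `μ`. -/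
def tail (μ : Measure ℝ) (v : ℝ) : ℝ := μ.real (Set.Ici v)

/-- The points strictly between the infimum and the supremum of the support of `μ`. -/
def innerRange (μ : Measure ℝ) : Set ℝ := {v | 0 < μ (Set.Iio v) ∧ 0 < μ (Set.Ioi v)}

/-- `μ` is a distribution of nonnegative values which, strictly below the supremum of its support,
has a density `f` (so the only possible atom is one at the supremum of the support), such that `f`
is positive strictly inside the range of values and `v ↦ φ v (1 - F(v)) (f v)` is non-decreasing
there. (At a point with `f v = 0` the virtual value is `-∞` and the hazard rate is `0`;
monotonicity rules this out strictly inside the range of values, hence the positivity.) -/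
def IsMonotoneDistribution (φ : ℝ → ℝ → ℝ → ℝ) (μ : Measure ℝ) : Prop :=
  IsProbabilityMeasure μ ∧ μ (Set.Iio 0) = 0 ∧
  ∃ f : ℝ → ℝ, Measurable f ∧
    μ.restrict {v | 0 < μ (Set.Ioi v)} =
      (volume.restrict {v | 0 < μ (Set.Ioi v)}).withDensity (fun v => ENNReal.ofReal (f v)) ∧
    (∀ v ∈ innerRange μ, 0 < f v) ∧
    MonotoneOn (fun v => φ v (tail μ v) (f v)) (innerRange μ)

/-- `lam`-regular distributions: `lam * v - (1 - F(v)) / f(v)` is non-decreasing. -/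
def lambdaRegular (lam : ℝ) : Set (Measure ℝ) :=
  {μ | IsMonotoneDistribution (fun v s d => lam * v - s / d) μ}

/-- Regular distributions: the virtual value `v - (1 - F(v)) / f(v)` is non-decreasing. -/
def regular : Set (Measure ℝ) :=
  {μ | IsMonotoneDistribution (fun v s d => v - s / d) μ}

/-- Monotone hazard rate distributions: `f(v) / (1 - F(v))` is non-decreasing. -/
def mhr : Set (Measure ℝ) :=
  {μ | IsMonotoneDistribution (fun _ s d => d / s) μ}

/-- Measures that have a density with respect to Lebesgue measure (no atom at all), and for which
some price `p` in the support maximizes the single-buyer revenue `p * (1 - F(p))`. -/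
def densityWithMonopolyPrice : Set (Measure ℝ) :=
  {μ | μ ≪ volume ∧ ∃ p ∈ μ.support, ∀ p' : ℝ, p' * tail μ p' ≤ p * tail μ p}

/-! ### Mechanisms for identical units and `n` unit-demand buyers -/

/-- Allocation rule (probability that a buyer gets a unit) and payment rule, as functions of the
bid profile. -/
structure Mechanism (n : ℕ) where
  alloc : (Fin n → ℝ) → Fin n → ℝ
  pay : (Fin n → ℝ) → Fin n → ℝ

namespace Mechanism

variable {n : ℕ}

/-- Measurability, allocation probabilities in `[0,1]`, nonnegative payments, and at most `m`
units allocated at every bid profile. -/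
def Feasible (M : Mechanism n) (m : ℕ) : Prop :=
  (∀ i, Measurable fun b => M.alloc b i) ∧ (∀ i, Measurable fun b => M.pay b i) ∧
  (∀ b i, 0 ≤ M.alloc b i ∧ M.alloc b i ≤ 1) ∧ (∀ b i, 0 ≤ M.pay b i) ∧
  ∀ b, ∑ i, M.alloc b i ≤ m

/-- Expected allocation of buyer `i` bidding `b` when the others bid their i.i.d. values. -/
def interimAlloc (M : Mechanism n) (μ : Measure ℝ) (i : Fin n) (b : ℝ) : ℝ :=
  ∫ v, M.alloc (Function.update v i b) i ∂(Measure.pi fun _ : Fin n => μ)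

/-- Expected payment of buyer `i` bidding `b` when the others bid their i.i.d. values. -/
def interimPay (M : Mechanism n) (μ : Measure ℝ) (i : Fin n) (b : ℝ) : ℝ≥0∞ :=
  ∫⁻ v, ENNReal.ofReal (M.pay (Function.update v i b) i) ∂(Measure.pi fun _ : Fin n => μ)

/-- Bayesian incentive compatibility: for every true value `v`, bidding `b` does not give a higher
interim utility than bidding `v`, that is `v X(b) - P(b) ≤ v X(v) - P(v)`, written without
subtraction. -/
def BIC (M : Mechanism n) (μ : Measure ℝ) : Prop :=
  ∀ i, ∀ v b : ℝ, 0 ≤ v → 0 ≤ b →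
    ENNReal.ofReal (v * M.interimAlloc μ i b) + M.interimPay μ i v ≤
      ENNReal.ofReal (v * M.interimAlloc μ i v) + M.interimPay μ i b

/-- Interim individual rationality: truthful bidding gives nonnegative interim utility. -/
def InterimIR (M : Mechanism n) (μ : Measure ℝ) : Prop :=
  ∀ i, ∀ v : ℝ, 0 ≤ v → M.interimPay μ i v ≤ ENNReal.ofReal (v * M.interimAlloc μ i v)

/-- Expected sum of payments when all buyers bid their i.i.d. values truthfully. -/
def revenue (M : Mechanism n) (μ : Measure ℝ) : ℝ≥0∞ :=
  ∫⁻ v, ∑ i, ENNReal.ofReal (M.pay v i) ∂(Measure.pi fun _ : Fin n => μ)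

end Mechanism

/-- Number of buyers ranked above buyer `i` by value, ties broken in favour of smaller indices. -/
def rank {n : ℕ} (v : Fin n → ℝ) (i : Fin n) : ℕ :=
  (Finset.univ.filter fun j => v i < v j ∨ (v j = v i ∧ j < i)).card

/-- The `(m+1)`-th highest value: the value of the buyer that has exactly `m` buyers ranked above
(`0` if there are at most `m` buyers). -/
def nextHighest {n : ℕ} (m : ℕ) (v : Fin n → ℝ) : ℝ :=
  ∑ j, if rank v j = m then v j else 0

/-- The VCG auction: the `m` highest-value buyers get a unit each and pay the `(m+1)`-th highest
value. -/
def vcg (m n : ℕ) : Mechanism n where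
  alloc v i := if rank v i < m then 1 else 0
  pay v i := if rank v i < m then nextHighest m v else 0

/-- Expected revenue of VCG for `m` units and `n` buyers. -/
def vcgRevenue (m n : ℕ) (μ : Measure ℝ) : ℝ≥0∞ := (vcg m n).revenue μ

/-- Bayesian-optimal revenue for `m` units and `n` buyers: the supremum of the expected revenue over
all feasible mechanisms that are Bayesian incentive compatible and interim individually rational. -/
def optRevenue (m n : ℕ) (μ : Measure ℝ) : ℝ≥0∞ :=
  ⨆ (M : Mechanism n) (_ : M.Feasible m ∧ M.BIC μ ∧ M.InterimIR μ), M.revenue μ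

/-! ### Competition complexity -/

/-- The least `k` such that VCG with `k` additional buyers gets at least a `Γ`-fraction of the
optimal revenue for every distribution in the class; `⊤` if there is no such `k`. -/
def competitionComplexity (m n : ℕ) (C : Set (Measure ℝ)) (Γ : ℝ) : ℕ∞ :=
  ⨅ (k : ℕ) (_ : ∀ μ ∈ C,
    ENNReal.ofReal Γ * optRevenue m n μ ≤ vcgRevenue m (n + k) μ), (k : ℕ∞)

/-- The asymptotic competition complexity with supply-to-demand ratio `α` exists and equals `L`:
with `m = ⌈α n⌉` units, the competition complexity divided by `n` tends to `L`. -/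
def HasAsymptoticCC (α : ℝ) (C : Set (Measure ℝ)) (Γ L : ℝ) : Prop :=
  Tendsto (fun n : ℕ => (competitionComplexity ⌈α * n⌉₊ n C Γ : ℝ≥0∞) / (n : ℝ≥0∞))
    atTop (𝓝 (ENNReal.ofReal L))

end Auction

end

noncomputable section

namespace Auction

/-! ### A comparison principle -/

/-! Posting price `v` to one buyer sells with probability `q = tail μ v`, so the revenue curve of
`μ` consists of the points `(q, v * q)`. The proof runs on affine majorants `v * tail μ v ≤ A + B *
tail μ v` with `A ≥ 0`. Incentive compatible payments are dominated by mixtures of posted prices, so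
a buyer served with probability `p` pays at most `A + B * p` on average. Summing over buyers gives
the bound `n * A + m * B`, both for the optimum (`optRevenue_le`, where `B ≥ 0`) and for VCG
(`vcgRevenue_le`).

Put `W q = (q ^ (-lam) - 1) / lam`, or `-log q` for `lam = 0`. This is the value at quantile `q` of
the generalized Pareto (exponential) distribution, whose `lam`-virtual value is constantly `-1`. In
essence `lam`-regularity says that `W ∘ tail μ` is convex; only its supporting lines are used
(`HasSupportingLines`).

Upper bound. Let `v₁` be the value at quantile `θ`. A supporting line of slope `s` gives `v ≤ v₁ +
(W q - W θ) / s`, and at `v = 0` it gives `W θ ≤ s * v₁`. Together with `q * W q ≤ κ + D * q` this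
is an affine majorant, and the optimum is at most `v₁ * max m ((n κ + m D) / W θ)`
(`exists_optRevenue_le`). If `N θ` exceeds `m` by a linear margin, VCG with `N` buyers sells all
units at price at least `v₁` with probability tending to 1. So `x n` extra buyers suffice once `Γ
(κ/α + D) < W θ` and `α < (1 + x) θ` (`eventually_le_vcgRevenue`). If `α` is at least the monopoly
quantile `(1 - lam) ^ (1 / lam)`, take `D = 0` and `κ = K`, the maximum of `q * W q`; the critical
`θ` solves `W θ = Γ K / α`. Otherwise take the tangent at `α` and `θ = α`: then `κ/α + D = W α`, and
since `Γ < 1` every `x > 0` works.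

Lower bound. Take the distribution with value curve `W` itself. Posting its monopoly price yields
about `n K` when the monopoly quantile is at most `α`. The tangent at `β = α / (1 + x)` caps VCG
with at most `(1 + x) n` buyers at about `n α W β`, so `α W β < Γ K` rules them out
(`eventually_lt_of_hasValueCurve`). These distributions have a density and a monopoly price, hence
lie in `D`. For `lam = 1` no monopoly price exists, and `lam < 1` close to 1 is used instead. MHR is
the case `lam = 0`, regularity the case `lam = 1`. -/

lemma mul_le_mul_of_le_density {T f l y : ℝ → ℝ} {a b : ℝ} (hab : a ≤ b)
    (hf : IntervalIntegrable f volume a b)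
    (hT : ∀ x ∈ Set.Icc a b, T x = T b + ∫ t in x..b, f t)
    (hl : ∀ x ∈ Set.Icc a b, 0 < l x) (hlc : ContinuousOn l (Set.Icc a b))
    (hy : ∀ x ∈ Set.Icc a b, 0 < y x)
    (hy' : ∀ x ∈ Set.Icc a b, HasDerivAt y (y x / l x) x) :
    ((∀ᵐ x, x ∈ Set.Ioo a b → T x / l x ≤ f x) → T b * y b ≤ T a * y a) ∧
    ((∀ᵐ x, x ∈ Set.Ioo a b → f x ≤ T x / l x) → T a * y a ≤ T b * y b) := by
  have hu : Set.uIcc a b = Set.Icc a b := Set.uIcc_of_le hab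
  have hTc : ContinuousOn T (Set.Icc a b) := by
    have h1 : ContinuousOn (fun x => T b + ∫ t in x..b, f t) (Set.Icc a b) := by
      apply continuousOn_const.add
      rw [← hu]
      exact intervalIntegral.continuousOn_primitive_interval_left
        (by rw [hu, integrableOn_Icc_iff_integrableOn_Ioc]
            exact (intervalIntegrable_iff_integrableOn_Ioc_of_le hab).1 hf)
    exact h1.congr hT
  have hgc : ContinuousOn (fun x => T x / l x) (Set.Icc a b) :=
    hTc.div hlc fun x hx => (hl x hx).ne'
  have hgi : ∀ x ∈ Set.Icc a b, IntervalIntegrable (fun x => T x / l x) volume x b := fun x hx =>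
    (hgc.mono (Set.Icc_subset_Icc_left hx.1)).intervalIntegrable_of_Icc hx.2
  have hfi : ∀ x ∈ Set.Icc a b, IntervalIntegrable f volume x b := fun x hx =>
    hf.mono_set (by rw [hu, Set.uIcc_of_le hx.2]; exact Set.Icc_subset_Icc_left hx.1)
  set V : ℝ → ℝ := fun x => ∫ t in x..b, T t / l t with hV
  have hVc : ContinuousOn V (Set.Icc a b) := by
    rw [← hu]
    exact intervalIntegral.continuousOn_primitive_interval_left
      (by rw [hu]; exact hgc.integrableOn_Icc)
  have hV' : ∀ x ∈ Set.Ioo a b, HasDerivAt V (-(T x / l x)) x := fun x hx =>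
    intervalIntegral.integral_hasDerivAt_left (hgi x (Set.Ioo_subset_Icc_self hx))
      (ContinuousOn.stronglyMeasurableAtFilter isOpen_Ioo
        (hgc.mono Set.Ioo_subset_Icc_self) x hx)
      (hgc.continuousAt (Icc_mem_nhds hx.1 hx.2))
  -- `T` is only absolutely continuous, so `T * y` is not differentiated directly. Replacing `f` by
  -- the continuous `T / l` under the integral gives a differentiable comparison function that
  -- agrees with `T * y` at `b`.
  set Z : ℝ → ℝ := fun x => (T b + V x) * y x with hZ
  have hyc : ContinuousOn y (Set.Icc a b) := fun x hx => (hy' x hx).continuousAt.continuousWithinAt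
  have hZc : ContinuousOn Z (Set.Icc a b) := (continuousOn_const.add hVc).mul hyc
  have hZ' : ∀ x ∈ Set.Ioo a b, HasDerivAt Z (y x / l x * (T b + V x - T x)) x := fun x hx => by
    have := ((hV' x hx).const_add (T b)).mul (hy' x (Set.Ioo_subset_Icc_self hx))
    refine this.congr_deriv ?_
    ring
  have hVb : V b = 0 := by simp [hV]
  have ha : a ∈ Set.Icc a b := ⟨le_rfl, hab⟩
  have hb : b ∈ Set.Icc a b := ⟨hab, le_rfl⟩
  have hpos : ∀ x ∈ Set.Icc a b, 0 ≤ y x / l x := fun x hx => (div_pos (hy x hx) (hl x hx)).le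
  constructor
  · intro h
    have hle : ∀ x ∈ Set.Icc a b, T b + V x ≤ T x := fun x hx => by
      rw [hT x hx]
      gcongr
      refine intervalIntegral.integral_mono_ae_restrict hx.2 (hgi x hx) (hfi x hx) ?_
      rw [← Measure.restrict_congr_set Ioo_ae_eq_Icc]
      refine (ae_restrict_iff' measurableSet_Ioo).2 ?_
      filter_upwards [h] with t ht ht'
      exact ht ⟨hx.1.trans_lt ht'.1, ht'.2⟩
    have hanti : AntitoneOn Z (Set.Icc a b) := by
      refine antitoneOn_of_deriv_nonpos (convex_Icc a b) hZc ?_ ?_ <;> rw [interior_Icc]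
      · exact fun x hx => (hZ' x hx).differentiableAt.differentiableWithinAt
      · intro x hx
        rw [(hZ' x hx).deriv]
        have hx' := Set.Ioo_subset_Icc_self hx
        nlinarith [hpos x hx', hle x hx']
    have h1 := hanti ha hb hab
    simp only [hZ, hVb, add_zero] at h1
    exact h1.trans (mul_le_mul_of_nonneg_right (hle a ha) (hy a ha).le)
  · intro h
    have hle : ∀ x ∈ Set.Icc a b, T x ≤ T b + V x := fun x hx => by
      rw [hT x hx]
      gcongr
      refine intervalIntegral.integral_mono_ae_restrict hx.2 (hfi x hx) (hgi x hx) ?_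
      rw [← Measure.restrict_congr_set Ioo_ae_eq_Icc]
      refine (ae_restrict_iff' measurableSet_Ioo).2 ?_
      filter_upwards [h] with t ht ht'
      exact ht ⟨hx.1.trans_lt ht'.1, ht'.2⟩
    have hmono : MonotoneOn Z (Set.Icc a b) := by
      refine monotoneOn_of_deriv_nonneg (convex_Icc a b) hZc ?_ ?_ <;> rw [interior_Icc]
      · exact fun x hx => (hZ' x hx).differentiableAt.differentiableWithinAt
      · intro x hx
        rw [(hZ' x hx).deriv]
        have hx' := Set.Ioo_subset_Icc_self hx
        nlinarith [hpos x hx', hle x hx']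
    have h1 := hmono ha hb hab
    simp only [hZ, hVb, add_zero] at h1
    exact (mul_le_mul_of_nonneg_right (hle a ha) (hy a ha).le).trans h1

/-! ### Tails of distributions -/

lemma tail_nonneg (μ : Measure ℝ) (v : ℝ) : 0 ≤ tail μ v := measureReal_nonneg

lemma tail_le_one (μ : Measure ℝ) [IsProbabilityMeasure μ] (v : ℝ) : tail μ v ≤ 1 :=
  measureReal_le_one

lemma tail_anti (μ : Measure ℝ) [IsProbabilityMeasure μ] : Antitone (tail μ) := fun _ _ h =>
  measureReal_mono (Set.Ici_subset_Ici.2 h)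

lemma ofReal_tail (μ : Measure ℝ) [IsProbabilityMeasure μ] (v : ℝ) :
    ENNReal.ofReal (tail μ v) = μ (Set.Ici v) := ofReal_measureReal

lemma tail_zero (μ : Measure ℝ) [IsProbabilityMeasure μ] (h0 : μ (Set.Iio 0) = 0) :
    tail μ 0 = 1 := by
  have h := prob_compl_eq_one_sub (μ := μ) (measurableSet_Iio (a := (0 : ℝ)))
  rw [Set.compl_Iio, h0, tsub_zero] at h
  simp [tail, Measure.real, h]

lemma tail_eq_add_Ico (μ : Measure ℝ) [IsProbabilityMeasure μ] {a b : ℝ} (hab : a ≤ b) :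
    tail μ a = tail μ b + μ.real (Set.Ico a b) := by
  rw [tail, ← Set.Ico_union_Ici_eq_Ici hab, measureReal_union _ measurableSet_Ici, add_comm]
  · rfl
  · exact Set.disjoint_left.2 fun x hx hx' => not_le.2 hx.2 hx'

lemma measure_eq_lintegral_density {μ : Measure ℝ} {f : ℝ → ℝ}
    (hf : μ.restrict {v | 0 < μ (Set.Ioi v)} =
      (volume.restrict {v | 0 < μ (Set.Ioi v)}).withDensity (fun v => ENNReal.ofReal (f v)))
    {A : Set ℝ} (hA : MeasurableSet A) (hAS : A ⊆ {v | 0 < μ (Set.Ioi v)}) :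
    μ A = ∫⁻ x in A, ENNReal.ofReal (f x) := by
  have h := congrArg (fun ν : Measure ℝ => ν A) hf
  rw [Measure.restrict_apply hA, Set.inter_eq_left.2 hAS, withDensity_apply _ hA,
    Measure.restrict_restrict hA, Set.inter_eq_left.2 hAS] at h
  exact h

/-- The density is `ENNReal.ofReal (f v)`, which truncates negative values of `f`; hence `max (f t)
0`. -/
lemma tail_eq_add_integral {μ : Measure ℝ} [IsProbabilityMeasure μ] {f : ℝ → ℝ}
    (hfm : Measurable f)
    (hf : μ.restrict {v | 0 < μ (Set.Ioi v)} =
      (volume.restrict {v | 0 < μ (Set.Ioi v)}).withDensity (fun v => ENNReal.ofReal (f v)))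
    {a b : ℝ} (hab : a ≤ b) (hS : Set.Ico a b ⊆ {v | 0 < μ (Set.Ioi v)}) :
    IntervalIntegrable (fun x => max (f x) 0) volume a b ∧
      ∀ x ∈ Set.Icc a b, tail μ x = tail μ b + ∫ t in x..b, max (f t) 0 := by
  have key : ∀ x ∈ Set.Icc a b,
      μ (Set.Ico x b) = ∫⁻ t in Set.Ioc x b, ENNReal.ofReal (max (f t) 0) := fun x hx => by
    rw [measure_eq_lintegral_density hf measurableSet_Ico
      ((Set.Ico_subset_Ico_left hx.1).trans hS),
      Measure.restrict_congr_set (Ico_ae_eq_Ioc (a := x) (b := b))]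
    simp [ENNReal.ofReal_max]
  have hm : Measurable fun x => max (f x) 0 := hfm.max measurable_const
  have hn : ∀ x, 0 ≤ max (f x) 0 := fun x => le_max_right _ _
  constructor
  · rw [intervalIntegrable_iff_integrableOn_Ioc_of_le hab]
    refine ⟨hm.aestronglyMeasurable, ?_⟩
    rw [hasFiniteIntegral_iff_ofReal (ae_of_all _ hn),
      ← key a ⟨le_rfl, hab⟩]
    exact measure_lt_top _ _
  · intro x hx
    rw [tail_eq_add_Ico μ hx.2, intervalIntegral.integral_of_le hx.2,
      integral_eq_lintegral_of_nonneg_ae (ae_of_all _ hn)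
        hm.aestronglyMeasurable, ← key x hx]
    rfl

lemma measure_singleton_eq_zero {μ : Measure ℝ} {f : ℝ → ℝ}
    (hf : μ.restrict {v | 0 < μ (Set.Ioi v)} =
      (volume.restrict {v | 0 < μ (Set.Ioi v)}).withDensity (fun v => ENNReal.ofReal (f v)))
    {v : ℝ} (hv : 0 < μ (Set.Ioi v)) : μ {v} = 0 := by
  rw [measure_eq_lintegral_density hf (measurableSet_singleton v) (by simpa using hv)]
  simp

lemma tail_pos_of_mem {μ : Measure ℝ} [IsProbabilityMeasure μ] {v : ℝ}
    (hv : 0 < μ (Set.Ioi v)) : 0 < tail μ v :=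
  ENNReal.toReal_pos (hv.trans_le (measure_mono Set.Ioi_subset_Ici_self)).ne'
    (measure_ne_top _ _)

/-- Comparison of the tail of a `lam`-regular distribution with the tail of the distribution of
constant `lam`-virtual value that agrees with it to first order at `v₁`. -/
lemma tail_mul_le {lam : ℝ} {μ : Measure ℝ} (hlam : 0 ≤ lam) (hμ : μ ∈ lambdaRegular lam) {v₁ : ℝ}
    (hv₁ : v₁ ∈ innerRange μ) :
    ∃ h₁ > 0, ∀ y : ℝ → ℝ,
      (∀ x, 0 < h₁ + lam * (x - v₁) → 0 < y x ∧ HasDerivAt y (y x / (h₁ + lam * (x - v₁))) x) →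
      ∀ v, 0 < tail μ v → 0 < h₁ + lam * (v - v₁) → tail μ v * y v ≤ tail μ v₁ * y v₁ := by
  obtain ⟨hprob, h0, f, hfm, hf, hpos, hmono⟩ := hμ
  have hT1 : 0 < tail μ v₁ := tail_pos_of_mem hv₁.2
  refine ⟨tail μ v₁ / f v₁, div_pos hT1 (hpos _ hv₁), fun y hy v hv hlv => ?_⟩
  set h₁ := tail μ v₁ / f v₁ with hh₁
  have hh₁pos : 0 < h₁ := div_pos hT1 (hpos _ hv₁)
  have hlc : Continuous fun x => h₁ + lam * (x - v₁) := by fun_prop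
  have hSlt : ∀ {x z : ℝ}, x < z → 0 < tail μ z → 0 < μ (Set.Ioi x) := fun {x z} hxz hz => by
    have : 0 < μ (Set.Ici z) := by rw [← ofReal_tail]; exact ENNReal.ofReal_pos.2 hz
    exact this.trans_le (measure_mono fun t ht => hxz.trans_le ht)
  have hLlt : ∀ {x z : ℝ}, x ≤ z → 0 < μ (Set.Iio x) → 0 < μ (Set.Iio z) := fun hxz hx =>
    hx.trans_le (measure_mono (Set.Iio_subset_Iio hxz))
  rcases le_total v₁ v with h | h
  · obtain ⟨hi, hT⟩ := tail_eq_add_integral hfm hf h fun x hx => hSlt hx.2 hv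
    have hl : ∀ x ∈ Set.Icc v₁ v, 0 < h₁ + lam * (x - v₁) := fun x hx => by
      have := mul_nonneg hlam (sub_nonneg.2 hx.1)
      linarith
    refine (mul_le_mul_of_le_density h hi hT hl hlc.continuousOn (fun x hx => (hy x (hl x hx)).1)
      fun x hx => (hy x (hl x hx)).2).1 (ae_of_all _ fun x hx => ?_)
    have hxi : x ∈ innerRange μ := ⟨hLlt hx.1.le hv₁.1, hSlt hx.2 hv⟩
    have hm := hmono hv₁ hxi hx.1.le
    simp only [← hh₁] at hm
    refine le_trans ?_ (le_max_left _ _)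
    rw [div_le_iff₀ (hl x (Set.Ioo_subset_Icc_self hx)), mul_comm, ← div_le_iff₀ (hpos x hxi)]
    linarith
  · obtain ⟨hi, hT⟩ := tail_eq_add_integral hfm hf h fun x hx => hSlt hx.2 hT1
    have hl : ∀ x ∈ Set.Icc v v₁, 0 < h₁ + lam * (x - v₁) := fun x hx => by
      have := mul_le_mul_of_nonneg_left hx.1 hlam
      linarith
    refine (mul_le_mul_of_le_density h hi hT hl hlc.continuousOn (fun x hx => (hy x (hl x hx)).1)
      fun x hx => (hy x (hl x hx)).2).2 ?_
    -- Below the support the monotonicity hypothesis says nothing. These points form a `μ`-null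
    -- interval on which `μ` has density `f`, so `f ≤ 0` almost everywhere there.
    have hzero : ∀ᵐ x, x ∈ {x | μ (Set.Iio x) = 0} ∩ Set.Iio v₁ → f x ≤ 0 := by
      set N := {x | μ (Set.Iio x) = 0} ∩ Set.Iio v₁ with hN
      have hNm : MeasurableSet N := by
        refine Set.OrdConnected.measurableSet ⟨fun a ha b hb c hc => ⟨?_, hc.2.trans_lt hb.2⟩⟩
        exact measure_mono_null (Set.Iio_subset_Iio hc.2) hb.1
      have hNS : N ⊆ {v | 0 < μ (Set.Ioi v)} := fun x hx => hSlt hx.2 hT1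
      have hN0 : μ N = 0 := by
        rcases N.eq_empty_or_nonempty with hemp | ⟨z, hz⟩
        · simp [hemp]
        have hb : BddAbove N := ⟨v₁, fun x hx => hx.2.le⟩
        by_cases hs : sSup N ∈ N
        · have hsub : N ⊆ Set.Iio (sSup N) ∪ {sSup N} := fun x hx => by
            rcases (le_csSup hb hx).lt_or_eq with h | h
            · exact Or.inl h
            · exact Or.inr h
          exact measure_mono_null hsub (measure_union_null hs.1
            (measure_singleton_eq_zero hf (hNS hs)))
        · obtain ⟨u, -, hu, huN⟩ := exists_seq_tendsto_sSup ⟨z, hz⟩ hb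
          have hsub : N ⊆ ⋃ n, Set.Iio (u n) := fun x hx => by
            have hlt : x < sSup N := lt_of_le_of_ne (le_csSup hb hx) fun h => hs (h ▸ hx)
            obtain ⟨n, hn⟩ := (hu.eventually (lt_mem_nhds hlt)).exists
            exact Set.mem_iUnion.2 ⟨n, hn⟩
          exact measure_mono_null hsub (measure_iUnion_null fun n => (huN n).1)
      rw [measure_eq_lintegral_density hf hNm hNS,
        lintegral_eq_zero_iff hfm.ennreal_ofReal] at hN0
      filter_upwards [(ae_restrict_iff' hNm).1 hN0] with x hx hxN
      simpa using hx hxN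
    filter_upwards [hzero] with x hx hxv
    have hlx := hl x (Set.Ioo_subset_Icc_self hxv)
    by_cases hx0 : μ (Set.Iio x) = 0
    · rw [max_eq_right (hx ⟨hx0, hxv.2⟩)]
      exact div_nonneg (tail_nonneg _ _) hlx.le
    · have hxi : x ∈ innerRange μ := ⟨pos_iff_ne_zero.2 hx0, hSlt hxv.2 hT1⟩
      have hm := hmono hxi hv₁ hxv.2.le
      simp only [← hh₁] at hm
      rw [max_eq_left (hpos x hxi).le, le_div_iff₀ hlx, mul_comm, ← le_div_iff₀ (hpos x hxi)]
      linarith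

/-- `W ∘ tail μ` lies above a line of positive slope through each inner point. -/
def HasSupportingLines (W : ℝ → ℝ) (μ : Measure ℝ) : Prop :=
  ∀ v₁ ∈ innerRange μ, ∃ s > 0, ∀ v, 0 < tail μ v →
    W (tail μ v₁) + s * (v - v₁) ≤ W (tail μ v)

/-- The comparison function is `y = (h₁ + lam * (x - v₁)) ^ (1 / lam)`, the reciprocal of a Pareto
tail up to a factor. Raising the inequality to the power `lam` makes it linear in `v`. Where `h₁ +
lam * (v - v₁) ≤ 0` the line is trivially below. -/
lemma hasSupportingLines_of_lambdaRegular {lam : ℝ} (hlam : 0 < lam) {μ : Measure ℝ}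
    (hμ : μ ∈ lambdaRegular lam) : HasSupportingLines (fun q => (q ^ (-lam) - 1) / lam) μ := by
  intro v₁ hv₁
  obtain ⟨h₁, hh₁, H⟩ := tail_mul_le hlam.le hμ hv₁
  have := hμ.1
  have hT1 : 0 < tail μ v₁ := tail_pos_of_mem hv₁.2
  have hp1 : 0 < tail μ v₁ ^ (-lam) := Real.rpow_pos_of_pos hT1 _
  refine ⟨tail μ v₁ ^ (-lam) / h₁, div_pos hp1 hh₁, fun v hv => ?_⟩
  have hpv : 0 < tail μ v ^ (-lam) := Real.rpow_pos_of_pos hv _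
  suffices h : tail μ v₁ ^ (-lam) * ((h₁ + lam * (v - v₁)) / h₁) ≤ tail μ v ^ (-lam) by
    have e : (tail μ v₁ ^ (-lam) - 1) / lam + tail μ v₁ ^ (-lam) / h₁ * (v - v₁) =
        (tail μ v₁ ^ (-lam) * ((h₁ + lam * (v - v₁)) / h₁) - 1) / lam := by
      field_simp; ring
    simp only []
    rw [e]
    gcongr
  rcases le_or_gt (h₁ + lam * (v - v₁)) 0 with hl | hl
  · exact (mul_nonpos_of_nonneg_of_nonpos hp1.le (div_nonpos_of_nonpos_of_nonneg hl hh₁.le)).trans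
      hpv.le
  have h := H (fun x => (h₁ + lam * (x - v₁)) ^ (1 / lam)) (fun x hx => ⟨by positivity, ?_⟩) v hv hl
  · have h2 : (tail μ v * (h₁ + lam * (v - v₁)) ^ (1 / lam)) ^ lam ≤
        (tail μ v₁ * (h₁ + lam * (v₁ - v₁)) ^ (1 / lam)) ^ lam :=
      Real.rpow_le_rpow (by positivity) h hlam.le
    rw [Real.mul_rpow hv.le (by positivity), Real.mul_rpow hT1.le (by simp; positivity),
      ← Real.rpow_mul hl.le, ← Real.rpow_mul (by simpa using hh₁.le), one_div_mul_cancel hlam.ne',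
      Real.rpow_one, Real.rpow_one, sub_self, mul_zero, add_zero] at h2
    rw [Real.rpow_neg hT1.le, Real.rpow_neg hv.le, ← div_eq_inv_mul, div_div,
      div_le_iff₀ (by positivity), ← div_eq_inv_mul, le_div_iff₀ (by positivity)]
    linarith
  · have h3 : HasDerivAt (fun x => h₁ + lam * (x - v₁)) lam x := by
      simpa using (((hasDerivAt_id x).sub_const v₁).const_mul lam).const_add h₁
    refine (h3.rpow_const (p := 1 / lam) (Or.inl hx.ne')).congr_deriv ?_
    rw [Real.rpow_sub hx, Real.rpow_one]
    field_simp

lemma hasSupportingLines_of_lambdaRegular_zero {μ : Measure ℝ}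
    (hμ : μ ∈ lambdaRegular 0) : HasSupportingLines (fun q => -Real.log q) μ := by
  intro v₁ hv₁
  obtain ⟨h₁, hh₁, H⟩ := tail_mul_le le_rfl hμ hv₁
  have := hμ.1
  have hT1 : 0 < tail μ v₁ := tail_pos_of_mem hv₁.2
  refine ⟨1 / h₁, by positivity, fun v hv => ?_⟩
  have h := H (fun x => Real.exp (x / h₁)) (fun x hx => ⟨by positivity, ?_⟩) v hv (by simpa)
  · have h2 := Real.log_le_log (by positivity) h
    rw [Real.log_mul hv.ne' (by positivity), Real.log_mul hT1.ne' (by positivity), Real.log_exp,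
      Real.log_exp] at h2
    have e : 1 / h₁ * (v - v₁) = v / h₁ - v₁ / h₁ := by ring
    simp only []
    rw [e]
    linarith
  · simpa [div_eq_mul_inv] using ((hasDerivAt_id x).div_const h₁).exp

/-! ### Revenue of a single buyer -/

/-- An upper set of bids is a half-line, and `c` is at most its left endpoint `p`. So `c * μ U` is
at most the revenue of a posted price, to which the affine majorant applies. -/
lemma mul_measure_le_of_isUpper {μ : Measure ℝ} [IsProbabilityMeasure μ] {A B : ℝ} (hA : 0 ≤ A)
    (h : ∀ v, 0 ≤ v → v * tail μ v ≤ A + B * tail μ v) {U : Set ℝ} (hU0 : U ⊆ Set.Ici 0)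
    (hU : ∀ x ∈ U, ∀ y, x ≤ y → y ∈ U) :
    0 ≤ A + B * μ.real U ∧ ∀ c : ℝ≥0∞, (∀ b ∈ U, c ≤ ENNReal.ofReal b) →
      c * μ U ≤ ENNReal.ofReal (A + B * μ.real U) := by
  rcases U.eq_empty_or_nonempty with rfl | hne
  · simp [hA]
  have hbdd : BddBelow U := ⟨0, fun x hx => hU0 hx⟩
  set p := sInf U with hp
  have hp0 : 0 ≤ p := le_csInf hne fun x hx => hU0 hx
  obtain ⟨z, hzanti, hz, hzU⟩ := exists_seq_tendsto_sInf hne hbdd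
  -- If the half-line is open at `p`, the bound at `p` itself would involve the closed tail; it is
  -- reached through prices in `U` decreasing to `p`.
  have hlim : ∃ z' : ℕ → ℝ, (∀ n, z' n ∈ U) ∧ Tendsto z' atTop (𝓝 p) ∧
      Tendsto (fun n => tail μ (z' n)) atTop (𝓝 (μ.real U)) := by
    by_cases hpU : p ∈ U
    · refine ⟨fun _ => p, fun _ => hpU, tendsto_const_nhds, ?_⟩
      have : U = Set.Ici p := Set.Subset.antisymm (fun x hx => csInf_le hbdd hx)
        fun x hx => hU p hpU x hx
      rw [this]
      exact tendsto_const_nhds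
    · refine ⟨z, hzU, hz, ?_⟩
      have hUz : U = ⋃ n, Set.Ici (z n) := by
        refine Set.Subset.antisymm (fun x hx => ?_)
          (Set.iUnion_subset fun n x hx => hU _ (hzU n) x hx)
        have hlt : p < x := lt_of_le_of_ne (csInf_le hbdd hx) fun h => hpU (h ▸ hx)
        obtain ⟨n, hn⟩ := (hz.eventually (gt_mem_nhds hlt)).exists
        exact Set.mem_iUnion.2 ⟨n, hn.le⟩
      have hm : Monotone fun n => Set.Ici (z n) := fun i j hij => Set.Ici_subset_Ici.2 (hzanti hij)
      rw [hUz]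
      exact (ENNReal.tendsto_toReal (measure_ne_top _ _)).comp (tendsto_measure_iUnion_atTop hm)
  obtain ⟨z, hzU, hz, hzt⟩ := hlim
  have hle : p * μ.real U ≤ A + B * μ.real U :=
    le_of_tendsto_of_tendsto' (hz.mul hzt) (tendsto_const_nhds.add (hzt.const_mul B))
      fun n => h _ (hU0 (hzU n))
  refine ⟨(mul_nonneg hp0 measureReal_nonneg).trans hle, fun c hc => ?_⟩
  have hcp : c ≤ ENNReal.ofReal p :=
    ge_of_tendsto' ((ENNReal.continuous_ofReal.tendsto p).comp hz) fun n => hc _ (hzU n)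
  calc c * μ U ≤ ENNReal.ofReal p * ENNReal.ofReal (μ.real U) := by
        rw [ofReal_measureReal]; gcongr
    _ = ENNReal.ofReal (p * μ.real U) := (ENNReal.ofReal_mul hp0).symm
    _ ≤ _ := ENNReal.ofReal_le_ofReal hle

/-- The price at which a buyer with allocation curve `X` reaches the allocation level `t`. -/
def levelPrice (X : ℝ → ℝ) (t : ℝ) : ℝ≥0∞ := ⨅ (z : ℝ) (_ : 0 ≤ z ∧ t < X z), ENNReal.ofReal z

lemma levelPrice_mono (X : ℝ → ℝ) : Monotone (levelPrice X) := fun _ _ hst =>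
  le_iInf₂ fun z hz => iInf₂_le z ⟨hz.1, hst.trans_lt hz.2⟩

/-- This is the payment formula as an inequality: the allocation layer at level `t` is bought at the
price `levelPrice X t`. -/
lemma payment_le_lintegral_levelPrice {X : ℝ → ℝ} {P : ℝ → ℝ≥0∞}
    (hX : MonotoneOn X (Set.Ici 0)) (hX0 : ∀ v, 0 ≤ X v) (hP0 : P 0 = 0)
    (hP : ∀ x y, 0 ≤ x → x ≤ y → P y ≤ P x + ENNReal.ofReal (y * (X y - X x)))
    {v : ℝ} (hv : 0 ≤ v) : P v ≤ ∫⁻ t in Set.Ico 0 (X v), levelPrice X t := by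
  set L : ℝ → ℝ≥0∞ := fun x => ∫⁻ t in Set.Ico 0 (X x), levelPrice X t with hL
  have hstep : ∀ x y, 0 ≤ x → x ≤ y →
      L x + ENNReal.ofReal (x * (X y - X x)) ≤ L y := fun x y hx hxy => by
    have hXxy : X x ≤ X y := hX hx (hx.trans hxy) hxy
    simp only [hL]
    rw [← Set.Ico_union_Ico_eq_Ico (hX0 x) hXxy, lintegral_union measurableSet_Ico
      (Set.Ico_disjoint_Ico_same)]
    gcongr
    calc ENNReal.ofReal (x * (X y - X x))
        = ∫⁻ _ in Set.Ico (X x) (X y), ENNReal.ofReal x := by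
          rw [setLIntegral_const, Real.volume_Ico, ENNReal.ofReal_mul hx]
      _ ≤ _ := by
          refine setLIntegral_mono (levelPrice_mono X).measurable fun t ht => ?_
          refine le_iInf₂ fun z hz => ENNReal.ofReal_le_ofReal ?_
          by_contra! hzx
          exact absurd (hX hz.1 hx hzx.le) (not_le.2 (ht.1.trans_lt hz.2))
  -- Over one grid step `P` grows by at most `y * ΔX` and the integral by at least `x * ΔX`, where
  -- `y = x + δ`. The errors `δ * ΔX` telescope to at most `δ * X`, which vanishes as `δ → 0`.
  have hgrid : ∀ δ : ℝ, 0 ≤ δ → ∀ k : ℕ, P (k * δ) ≤ L (k * δ) + ENNReal.ofReal (δ * X (k * δ)) := by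
    intro δ hδ k
    induction k with
    | zero => simp [hP0]
    | succ k ih =>
      set x := (k : ℝ) * δ with hx
      have hx0 : 0 ≤ x := by positivity
      have hy : ((k + 1 : ℕ) : ℝ) * δ = x + δ := by push_cast; rw [hx]; ring
      rw [hy]
      have hxy : x ≤ x + δ := by linarith
      have hd : 0 ≤ X (x + δ) - X x := sub_nonneg.2 (hX hx0 (hx0.trans hxy) hxy)
      calc P (x + δ) ≤ P x + ENNReal.ofReal ((x + δ) * (X (x + δ) - X x)) := hP x _ hx0 hxy
        _ ≤ L x + ENNReal.ofReal (δ * X x) + ENNReal.ofReal ((x + δ) * (X (x + δ) - X x)) := by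
            gcongr
        _ = L x + ENNReal.ofReal (x * (X (x + δ) - X x)) + ENNReal.ofReal (δ * X (x + δ)) := by
            rw [add_assoc, add_assoc, ← ENNReal.ofReal_add (mul_nonneg hδ (hX0 _))
              (mul_nonneg (by linarith) hd), ← ENNReal.ofReal_add (mul_nonneg hx0 hd)
              (mul_nonneg hδ (hX0 _))]
            congr 2
            ring
        _ ≤ _ := by gcongr; exact hstep x _ hx0 hxy
  have hlim : Tendsto (fun n : ℕ => L v + ENNReal.ofReal (v / (n + 1 : ℝ) * X v)) atTop
      (𝓝 (L v + ENNReal.ofReal (0 * X v))) := by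
    refine Tendsto.const_add _ ?_
    refine (ENNReal.continuous_ofReal.tendsto _).comp (Tendsto.mul_const _ ?_)
    exact tendsto_const_nhds.div_atTop
      (tendsto_natCast_atTop_atTop.atTop_add tendsto_const_nhds)
  have := ge_of_tendsto' hlim (b := P v) fun n => by
    have h := hgrid (v / (n + 1 : ℝ)) (by positivity) (n + 1)
    have e : ((n + 1 : ℕ) : ℝ) * (v / (n + 1 : ℝ)) = v := by push_cast; field_simp
    rwa [e] at h
  simpa using this

/-- By Tonelli the expected payment is an integral over levels `t` of `levelPrice X t * μ (U t)`,
with `U t` the upper set where `X > t`. Each layer is at most `A + B * μ (U t)`, and these measures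
integrate to the mean of `X`. -/
lemma lintegral_payment_le {μ : Measure ℝ} [IsProbabilityMeasure μ] (h0 : μ (Set.Iio 0) = 0)
    {A B : ℝ} (hA : 0 ≤ A) (h : ∀ v, 0 ≤ v → v * tail μ v ≤ A + B * tail μ v)
    {X : ℝ → ℝ} {P : ℝ → ℝ≥0∞} (hXm : Measurable X)
    (hX : MonotoneOn X (Set.Ici 0)) (hX0 : ∀ v, 0 ≤ X v) (hX1 : ∀ v, X v ≤ 1) (hP0 : P 0 = 0)
    (hP : ∀ x y, 0 ≤ x → x ≤ y → P y ≤ P x + ENNReal.ofReal (y * (X y - X x))) :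
    ∫⁻ v, P v ∂μ ≤ ENNReal.ofReal (A + B * ∫ v, X v ∂μ) := by
  set ν : Measure ℝ := volume.restrict (Set.Ico 0 1) with hν
  have hν1 : IsProbabilityMeasure ν := ⟨by simp [hν]⟩
  have hnn : ∀ᵐ v ∂μ, 0 ≤ v := by
    rw [ae_iff]; simp only [not_le]; exact h0
  set U : ℝ → Set ℝ := fun t => {v | 0 ≤ v ∧ t < X v} with hU
  have hJ : MeasurableSet {q : ℝ × ℝ | 0 ≤ q.1 ∧ q.2 < X q.1} :=
    (measurableSet_le measurable_const measurable_fst).inter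
      (measurableSet_lt measurable_snd (hXm.comp measurable_fst))
  have hUm : ∀ t, MeasurableSet (U t) := fun t => measurable_prodMk_right hJ
  have hUup : ∀ t, ∀ x ∈ U t, ∀ y, x ≤ y → y ∈ U t := fun t x hx y hxy =>
    ⟨hx.1.trans hxy, hx.2.trans_le (hX hx.1 (hx.1.trans hxy) hxy)⟩
  have hswap : ∀ g : ℝ → ℝ≥0∞, Measurable g →
      ∫⁻ v, (∫⁻ t in Set.Ico 0 (X v), g t) ∂μ = ∫⁻ t, g t * μ (U t) ∂ν := fun g hg => by
    have e1 : ∀ᵐ v ∂μ, ∫⁻ t in Set.Ico 0 (X v), g t =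
        ∫⁻ t, {q : ℝ × ℝ | 0 ≤ q.1 ∧ q.2 < X q.1}.indicator (fun q => g q.2) (v, t) ∂ν := by
      filter_upwards [hnn] with v hv
      have e2 : (fun t => {q : ℝ × ℝ | 0 ≤ q.1 ∧ q.2 < X q.1}.indicator (fun q => g q.2) (v, t)) =
          (Set.Iio (X v)).indicator g := by
        ext t
        simp [Set.indicator, hv]
      rw [e2, lintegral_indicator measurableSet_Iio, hν, Measure.restrict_restrict measurableSet_Iio]
      congr 2
      ext t
      simp only [Set.mem_Ico, Set.mem_inter_iff, Set.mem_Iio]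
      constructor
      · exact fun ht => ⟨ht.2, ht.1, ht.2.trans_le (hX1 v)⟩
      · exact fun ht => ⟨ht.2.1, ht.1⟩
    rw [lintegral_congr_ae e1, lintegral_lintegral_swap]
    · refine lintegral_congr fun t => ?_
      have e3 : (fun v => {q : ℝ × ℝ | 0 ≤ q.1 ∧ q.2 < X q.1}.indicator (fun q => g q.2) (v, t)) =
          (U t).indicator fun _ => g t := by
        ext v
        simp [Set.indicator, hU]
      rw [e3, lintegral_indicator_const (hUm t)]
    · exact ((hg.comp measurable_snd).indicator hJ).aemeasurable
  have hEX : ∫ v, X v ∂μ = ∫ t, μ.real (U t) ∂ν := by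
    have h1 := hswap (fun _ => 1) measurable_const
    simp only [setLIntegral_const, one_mul, Real.volume_Ico, sub_zero] at h1
    rw [integral_eq_lintegral_of_nonneg_ae (ae_of_all _ hX0) hXm.aestronglyMeasurable, h1]
    have hUa : Antitone fun t => μ (U t) := fun s t hst =>
      measure_mono fun v hv => ⟨hv.1, hst.trans_lt hv.2⟩
    rw [← integral_toReal hUa.measurable.aemeasurable (ae_of_all _ fun t => measure_lt_top _ _)]
    rfl
  have hgm : Measurable fun t => μ.real (U t) :=
    Antitone.measurable fun s t hst => measureReal_mono fun v hv => ⟨hv.1, hst.trans_lt hv.2⟩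
  have hgi : Integrable (fun t => μ.real (U t)) ν :=
    Integrable.of_bound hgm.aestronglyMeasurable 1 (ae_of_all _ fun t => by
      rw [Real.norm_of_nonneg measureReal_nonneg]; exact measureReal_le_one)
  calc ∫⁻ v, P v ∂μ ≤ ∫⁻ v, (∫⁻ t in Set.Ico 0 (X v), levelPrice X t) ∂μ := by
        refine lintegral_mono_ae ?_
        filter_upwards [hnn] with v hv
        exact payment_le_lintegral_levelPrice hX hX0 hP0 hP hv
    _ = ∫⁻ t, levelPrice X t * μ (U t) ∂ν := hswap _ (levelPrice_mono X).measurable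
    _ ≤ ∫⁻ t, ENNReal.ofReal (A + B * μ.real (U t)) ∂ν := lintegral_mono fun t =>
        (mul_measure_le_of_isUpper hA h (fun v hv => hv.1) (hUup t)).2 _ fun b hb =>
          iInf₂_le b hb
    _ = ENNReal.ofReal (∫ t, A + B * μ.real (U t) ∂ν) := by
        rw [ofReal_integral_eq_lintegral_ofReal]
        · exact (integrable_const A).add (hgi.const_mul B)
        · exact ae_of_all _ fun t => (mul_measure_le_of_isUpper hA h (fun v hv => hv.1) (hUup t)).1
    _ = _ := by
        rw [integral_add (integrable_const A) (hgi.const_mul B), integral_const_mul, hEX]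
        simp

/-! ### Resampling one coordinate of an i.i.d. profile -/

section IndependentProfiles

variable {n : ℕ}

lemma measurable_update_pair (i : Fin n) :
    Measurable fun q : (Fin n → ℝ) × ℝ => Function.update q.1 i q.2 := by
  refine measurable_pi_lambda _ fun j => ?_
  by_cases hj : j = i
  · subst hj; simpa using measurable_snd
  · simp only [Function.update_of_ne hj]
    exact (measurable_pi_apply j).comp measurable_fst

/-- This invariance turns interim quantities, averaged over the own bid, into expectations over
whole profiles. -/
lemma map_update_prod (μ : Measure ℝ) [IsProbabilityMeasure μ] (i : Fin n) :
    ((Measure.pi fun _ : Fin n => μ).prod μ).map (fun q => Function.update q.1 i q.2) =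
      Measure.pi fun _ : Fin n => μ := by
  symm
  refine Measure.pi_eq fun s hs => ?_
  rw [Measure.map_apply (measurable_update_pair i) (MeasurableSet.univ_pi hs)]
  have e : (fun q : (Fin n → ℝ) × ℝ => Function.update q.1 i q.2) ⁻¹' Set.pi Set.univ s =
      (Set.pi Set.univ (Function.update s i Set.univ)) ×ˢ s i := by
    ext q
    simp only [Set.mem_preimage, Set.mem_pi, Set.mem_univ, true_implies, Set.mem_prod]
    constructor
    · intro h
      refine ⟨fun j => ?_, by simpa using h i⟩
      by_cases hj : j = i
      · subst hj; simp
      · simpa [hj] using h j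
    · rintro ⟨h, h'⟩ j
      by_cases hj : j = i
      · subst hj; simpa using h'
      · simpa [hj] using h j
  rw [e, Measure.prod_prod, Measure.pi_pi, ← Finset.mul_prod_erase _ _ (Finset.mem_univ i),
    ← Finset.mul_prod_erase (s := Finset.univ) (f := fun j => μ (s j)) (Finset.mem_univ i)]
  rw [Finset.prod_congr rfl fun j hj => by rw [Function.update_of_ne (Finset.ne_of_mem_erase hj)]]
  simp [mul_comm]

lemma lintegral_update (μ : Measure ℝ) [IsProbabilityMeasure μ] (i : Fin n)
    {g : (Fin n → ℝ) → ℝ≥0∞} (hg : Measurable g) :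
    ∫⁻ v, ∫⁻ b, g (Function.update v i b) ∂μ ∂(Measure.pi fun _ : Fin n => μ) =
      ∫⁻ v, g v ∂(Measure.pi fun _ : Fin n => μ) := by
  conv_rhs => rw [← map_update_prod μ i, lintegral_map hg (measurable_update_pair i)]
  exact (lintegral_prod _ (hg.comp (measurable_update_pair i)).aemeasurable).symm

lemma lintegral_update' (μ : Measure ℝ) [IsProbabilityMeasure μ] (i : Fin n)
    {g : (Fin n → ℝ) → ℝ≥0∞} (hg : Measurable g) :
    ∫⁻ b, ∫⁻ v, g (Function.update v i b) ∂(Measure.pi fun _ : Fin n => μ) ∂μ =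
      ∫⁻ v, g v ∂(Measure.pi fun _ : Fin n => μ) := by
  rw [← lintegral_update μ i hg, lintegral_lintegral_swap]
  exact (hg.comp ((measurable_update_pair i).comp measurable_swap)).aemeasurable

lemma integral_update' (μ : Measure ℝ) [IsProbabilityMeasure μ] (i : Fin n)
    {g : (Fin n → ℝ) → ℝ} (hg : Measurable g) (hg0 : ∀ v, 0 ≤ g v) (hg1 : ∀ v, g v ≤ 1) :
    ∫ b, ∫ v, g (Function.update v i b) ∂(Measure.pi fun _ : Fin n => μ) ∂μ =
      ∫ v, g v ∂(Measure.pi fun _ : Fin n => μ) := by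
  have hi : Integrable (fun q : ℝ × (Fin n → ℝ) => g (Function.update q.2 i q.1))
      (μ.prod (Measure.pi fun _ : Fin n => μ)) :=
    Integrable.of_bound (hg.comp ((measurable_update_pair i).comp
      measurable_swap)).aestronglyMeasurable 1
      (ae_of_all _ fun q => by rw [Real.norm_of_nonneg (hg0 _)]; exact hg1 _)
  rw [integral_integral_swap hi]
  conv_rhs => rw [← map_update_prod μ i, integral_map (measurable_update_pair i).aemeasurable
    hg.aestronglyMeasurable]
  rw [integral_prod]
  exact hi.swap

/-! ### The revenue bound for Bayesian incentive compatible mechanisms -/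

namespace Mechanism

variable {M : Mechanism n} {m : ℕ} {μ : Measure ℝ}

/-- Individual rationality makes interim payments finite, so the incentive constraints can be read
in the reals. The two constraints between `x` and `y` give a monotone interim allocation, and one of
them bounds the payment increment. -/
lemma lintegral_pay_le [IsProbabilityMeasure μ] (h0 : μ (Set.Iio 0) = 0) (hF : M.Feasible m)
    (hB : M.BIC μ) (hI : M.InterimIR μ) {A B : ℝ} (hA : 0 ≤ A)
    (h : ∀ v, 0 ≤ v → v * tail μ v ≤ A + B * tail μ v) (i : Fin n) :
    ∫⁻ v, ENNReal.ofReal (M.pay v i) ∂(Measure.pi fun _ : Fin n => μ) ≤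
      ENNReal.ofReal (A + B * ∫ v, M.alloc v i ∂(Measure.pi fun _ : Fin n => μ)) := by
  obtain ⟨ham, hpm, ha, hp, -⟩ := hF
  rw [← lintegral_update' μ i (hpm i).ennreal_ofReal,
    ← integral_update' μ i (ham i) (fun v => (ha v i).1) (fun v => (ha v i).2)]
  have hX0 : ∀ b, 0 ≤ M.interimAlloc μ i b := fun b => integral_nonneg fun v => (ha _ i).1
  have hX1 : ∀ b, M.interimAlloc μ i b ≤ 1 := fun b => by
    refine (integral_mono_of_nonneg (ae_of_all _ fun v => (ha _ i).1) (integrable_const 1)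
      (ae_of_all _ fun v => (ha _ i).2)).trans ?_
    simp
  have hfin : ∀ v, 0 ≤ v → M.interimPay μ i v ≠ ⊤ := fun v hv =>
    ((hI i v hv).trans_lt ENNReal.ofReal_lt_top).ne
  have hbic : ∀ v b, 0 ≤ v → 0 ≤ b → v * M.interimAlloc μ i b + (M.interimPay μ i v).toReal ≤
      v * M.interimAlloc μ i v + (M.interimPay μ i b).toReal := fun v b hv hb => by
    have h1 := hB i v b hv hb
    rw [← ENNReal.ofReal_toReal (hfin v hv), ← ENNReal.ofReal_toReal (hfin b hb),
      ← ENNReal.ofReal_add (mul_nonneg hv (hX0 b)) ENNReal.toReal_nonneg,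
      ← ENNReal.ofReal_add (mul_nonneg hv (hX0 v)) ENNReal.toReal_nonneg] at h1
    exact (ENNReal.ofReal_le_ofReal_iff
      (add_nonneg (mul_nonneg hv (hX0 v)) ENNReal.toReal_nonneg)).1 h1
  refine lintegral_payment_le h0 hA h (X := M.interimAlloc μ i) (P := M.interimPay μ i)
    ?_ ?_ hX0 hX1 ?_ ?_
  · have hsm : StronglyMeasurable
        (fun q : ℝ × (Fin n → ℝ) => M.alloc (Function.update q.2 i q.1) i) :=
      ((ham i).comp ((measurable_update_pair i).comp measurable_swap)).stronglyMeasurable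
    exact hsm.integral_prod_right.measurable
  · intro x hx y hy hxy
    rcases hxy.eq_or_lt with rfl | hlt
    · exact le_rfl
    have h1 := hbic x y hx hy
    have h2 := hbic y x hy hx
    by_contra! hcon
    nlinarith [mul_pos (sub_pos.2 hlt) (sub_pos.2 hcon)]
  · have := hI i 0 le_rfl
    simpa using this
  · intro x y hx hxy
    have h1 := hbic y x (hx.trans hxy) hx
    rw [← ENNReal.ofReal_toReal (hfin y (hx.trans hxy)), ← ENNReal.ofReal_toReal (hfin x hx)]
    refine (ENNReal.ofReal_le_ofReal (q := (M.interimPay μ i x).toReal +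
      y * (M.interimAlloc μ i y - M.interimAlloc μ i x)) (by linarith)).trans ENNReal.ofReal_add_le

lemma revenue_le [IsProbabilityMeasure μ] (h0 : μ (Set.Iio 0) = 0) (hF : M.Feasible m)
    (hB : M.BIC μ) (hI : M.InterimIR μ) {A B : ℝ} (hA : 0 ≤ A) (hB0 : 0 ≤ B)
    (h : ∀ v, 0 ≤ v → v * tail μ v ≤ A + B * tail μ v) :
    M.revenue μ ≤ ENNReal.ofReal (n * A + m * B) := by
  rw [revenue, lintegral_finsetSum _ fun i _ => (hF.2.1 i).ennreal_ofReal]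
  refine (Finset.sum_le_sum fun i _ => lintegral_pay_le h0 hF hB hI hA h i).trans ?_
  have ha : ∀ i, 0 ≤ ∫ v, M.alloc v i ∂(Measure.pi fun _ : Fin n => μ) := fun i =>
    integral_nonneg fun v => (hF.2.2.1 v i).1
  rw [← ENNReal.ofReal_sum_of_nonneg fun i _ => add_nonneg hA (mul_nonneg hB0 (ha i))]
  refine ENNReal.ofReal_le_ofReal ?_
  rw [Finset.sum_add_distrib, ← Finset.mul_sum]
  have hint : ∀ i, Integrable (fun v => M.alloc v i) (Measure.pi fun _ : Fin n => μ) := fun i =>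
    Integrable.of_bound (hF.1 i).aestronglyMeasurable 1 (ae_of_all _ fun v => by
      rw [Real.norm_of_nonneg (hF.2.2.1 v i).1]; exact (hF.2.2.1 v i).2)
  have hs : ∑ i, ∫ v, M.alloc v i ∂(Measure.pi fun _ : Fin n => μ) ≤ m := by
    rw [← integral_finsetSum _ fun i _ => hint i]
    refine (integral_mono (integrable_finsetSum _ fun i _ => hint i) (integrable_const (m : ℝ))
      fun v => hF.2.2.2.2 v).trans ?_
    simp
  simp only [Finset.sum_const, Finset.card_univ, Fintype.card_fin, nsmul_eq_mul]
  nlinarith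

end Mechanism

lemma optRevenue_le {μ : Measure ℝ} [IsProbabilityMeasure μ] (h0 : μ (Set.Iio 0) = 0) {m : ℕ}
    {A B : ℝ} (hA : 0 ≤ A) (hB0 : 0 ≤ B)
    (h : ∀ v, 0 ≤ v → v * tail μ v ≤ A + B * tail μ v) :
    optRevenue m n μ ≤ ENNReal.ofReal (n * A + m * B) :=
  iSup₂_le fun _ hM => Mechanism.revenue_le h0 hM.1 hM.2.1 hM.2.2 hA hB0 h

end IndependentProfiles

/-! ### Order statistics -/

section Rank

variable {n : ℕ}

lemma rank_lt_rank {v : Fin n → ℝ} {i j : Fin n} (h : v i < v j ∨ (v j = v i ∧ j < i)) :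
    rank v j < rank v i := by
  refine Finset.card_lt_card ⟨fun k hk => ?_, fun hsub => ?_⟩
  · simp only [Finset.mem_filter, Finset.mem_univ, true_and] at hk ⊢
    rcases h with h | ⟨h, h'⟩ <;> rcases hk with hk | ⟨hk, hk'⟩
    · exact Or.inl (h.trans hk)
    · exact Or.inl (by rwa [hk])
    · exact Or.inl (by rwa [← h])
    · exact Or.inr ⟨hk.trans h, hk'.trans h'⟩
  · have := hsub (Finset.mem_filter.2 ⟨Finset.mem_univ j, h⟩)
    simp at this

lemma rank_injective (v : Fin n → ℝ) : Function.Injective (rank v) := by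
  intro i j hij
  by_contra hne
  rcases lt_trichotomy (v i) (v j) with h | h | h
  · exact (rank_lt_rank (Or.inl h)).ne hij.symm
  · rcases lt_or_gt_of_ne hne with h' | h'
    · exact (rank_lt_rank (Or.inr ⟨h, h'⟩)).ne hij
    · exact (rank_lt_rank (Or.inr ⟨h.symm, h'⟩)).ne hij.symm
  · exact (rank_lt_rank (Or.inl h)).ne hij

lemma rank_lt (v : Fin n → ℝ) (i : Fin n) : rank v i < n := by
  have : rank v i < (Finset.univ : Finset (Fin n)).card :=
    Finset.card_lt_card (Finset.filter_ssubset.2 ⟨i, Finset.mem_univ i, by simp⟩)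
  simpa using this

lemma exists_rank_eq (v : Fin n → ℝ) {m : ℕ} (hm : m < n) : ∃ j, rank v j = m := by
  have hinj : Function.Injective fun i => (⟨rank v i, rank_lt v i⟩ : Fin n) := fun i j h =>
    rank_injective v (by simpa using h)
  obtain ⟨j, hj⟩ := (Finite.injective_iff_surjective.1 hinj) ⟨m, hm⟩
  exact ⟨j, by simpa using hj⟩

lemma card_rank_lt (v : Fin n → ℝ) {m : ℕ} (hm : m ≤ n) :
    (Finset.univ.filter fun i => rank v i < m).card = m := by
  have h : (Finset.univ.filter fun i => rank v i < m).image (rank v) = Finset.range m := by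
    ext k
    simp only [Finset.mem_image, Finset.mem_filter, Finset.mem_univ, true_and, Finset.mem_range]
    constructor
    · rintro ⟨i, hi, rfl⟩; exact hi
    · intro hk
      obtain ⟨j, rfl⟩ := exists_rank_eq v (hk.trans_le hm)
      exact ⟨j, hk, rfl⟩
  rw [← Finset.card_image_of_injective _ (rank_injective v), h, Finset.card_range]

lemma nextHighest_eq {v : Fin n → ℝ} {j : Fin n} {m : ℕ} (hj : rank v j = m) :
    nextHighest m v = v j := by
  rw [nextHighest, Finset.sum_eq_single j]
  · simp [hj]
  · intro k _ hk
    rw [if_neg fun h => hk (rank_injective v (h.trans hj.symm))]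
  · simp

lemma le_nextHighest {v : Fin n → ℝ} {m : ℕ} {c : ℝ}
    (h : m < (Finset.univ.filter fun j => c ≤ v j).card) : c ≤ nextHighest m v := by
  have hmn : m < n := h.trans_le ((Finset.card_le_univ _).trans (by simp))
  obtain ⟨j, hj⟩ := exists_rank_eq v hmn
  rw [nextHighest_eq hj]
  by_contra! hc
  have hsub : (Finset.univ.filter fun k => c ≤ v k) ⊆ Finset.univ.filter fun k => rank v k < m := by
    intro k hk
    simp only [Finset.mem_filter, Finset.mem_univ, true_and] at hk ⊢
    rw [← hj]
    exact rank_lt_rank (Or.inl (hc.trans_le hk))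
  have := Finset.card_le_card hsub
  rw [card_rank_lt v hmn.le] at this
  omega

lemma rank_update_anti (v : Fin n → ℝ) (i : Fin n) {b b' : ℝ} (h : b ≤ b') :
    rank (Function.update v i b') i ≤ rank (Function.update v i b) i := by
  refine Finset.card_le_card fun k hk => ?_
  simp only [Finset.mem_filter, Finset.mem_univ, true_and] at hk ⊢
  by_cases hki : k = i
  · subst hki; simp at hk
  · simp only [Function.update_self, Function.update_of_ne hki] at hk ⊢
    rcases hk with hk | ⟨hk, hk'⟩
    · exact Or.inl (h.trans_lt hk)
    · rcases h.lt_or_eq with h | h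
      · exact Or.inl (hk ▸ h)
      · exact Or.inr ⟨hk.trans h.symm, hk'⟩

/-- The price a winner pays is at most any bid with which he wins. -/
lemma nextHighest_update_le {v : Fin n → ℝ} {i : Fin n} {b b' : ℝ} {m : ℕ} (hb' : 0 ≤ b')
    (hw : rank (Function.update v i b) i < m) (hw' : rank (Function.update v i b') i < m) :
    nextHighest m (Function.update v i b) ≤ b' := by
  rcases lt_or_ge m n with hmn | hmn
  · obtain ⟨j, hj⟩ := exists_rank_eq (Function.update v i b) hmn
    have hji : j ≠ i := by rintro rfl; omega
    rw [nextHighest_eq hj, Function.update_of_ne hji]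
    by_contra! hlt
    have h1 : rank (Function.update v i b') j < rank (Function.update v i b') i :=
      rank_lt_rank (Or.inl (by simpa [hji] using hlt))
    -- Only buyer `i` can change sides, so the rank of `j` drops by at most one, to at least `m -
    -- 1`. But at bid `b'` it would have to lie below the rank of a winner.
    have h2 : rank (Function.update v i b) j ≤ rank (Function.update v i b') j + 1 := by
      refine le_trans (Finset.card_le_card fun k hk => ?_) (Finset.card_insert_le i _)
      simp only [Finset.mem_filter, Finset.mem_univ, true_and, Finset.mem_insert] at hk ⊢
      by_cases hki : k = i
      · exact Or.inl hki
      · simpa [hki, hji] using hk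
    omega
  · rw [nextHighest, Finset.sum_eq_zero]
    · exact hb'
    · intro j _
      rw [if_neg]
      have := rank_lt (Function.update v i b) j
      omega

lemma measurable_rank (i : Fin n) : Measurable fun v : Fin n → ℝ => rank v i := by
  simp only [rank, Finset.card_filter]
  refine Finset.measurable_fun_sum _ fun j _ => ?_
  refine Measurable.ite ?_ measurable_const measurable_const
  refine MeasurableSet.union (measurableSet_lt (measurable_pi_apply i) (measurable_pi_apply j)) ?_
  refine MeasurableSet.inter
    (measurableSet_eq_fun (measurable_pi_apply j) (measurable_pi_apply i)) ?_
  exact MeasurableSet.const _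

lemma measurable_nextHighest (m : ℕ) : Measurable fun v : Fin n → ℝ => nextHighest m v :=
  Finset.measurable_fun_sum _ fun j _ =>
    Measurable.ite (measurable_rank j (measurableSet_singleton m)) (measurable_pi_apply j)
      measurable_const

lemma measurableSet_rank_lt (m : ℕ) (i : Fin n) :
    MeasurableSet {v : Fin n → ℝ | rank v i < m} :=
  measurable_rank i (measurableSet_Iio (a := m))

lemma measurable_vcg_pay (m : ℕ) (i : Fin n) : Measurable fun v => (vcg m n).pay v i :=
  Measurable.ite (measurableSet_rank_lt m i) (measurable_nextHighest m) measurable_const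

end Rank

/-! ### Bounds on the revenue of the VCG auction -/

section VCG

variable {n m : ℕ} {μ : Measure ℝ}

/-- Markov's inequality: VCG collects at least `c * m` whenever more than `m` values reach `c`. -/
lemma le_vcgRevenue (hmn : m ≤ n) (c : ℝ) :
    ENNReal.ofReal c * m * (Measure.pi fun _ : Fin n => μ)
      {v | m < (Finset.univ.filter fun j => c ≤ v j).card} ≤ vcgRevenue m n μ := by
  rw [vcgRevenue, Mechanism.revenue]
  refine (mul_meas_ge_le_lintegral₀ ?_ (ENNReal.ofReal c * m)).trans' ?_
  · exact (Finset.measurable_fun_sum _ fun i _ =>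
      (measurable_vcg_pay m i).ennreal_ofReal).aemeasurable
  · refine mul_le_mul' le_rfl (measure_mono fun v hv => ?_)
    have hle := le_nextHighest hv
    calc ENNReal.ofReal c * m = ∑ i ∈ Finset.univ.filter fun i => rank v i < m,
          ENNReal.ofReal c := by rw [Finset.sum_const, card_rank_lt v hmn]; simp [mul_comm]
      _ ≤ ∑ i ∈ Finset.univ.filter fun i => rank v i < m,
          ENNReal.ofReal ((vcg m n).pay v i) := Finset.sum_le_sum fun i hi => by
            simp only [Finset.mem_filter] at hi
            simp only [vcg, if_pos hi.2]
            exact ENNReal.ofReal_le_ofReal hle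
      _ ≤ _ := Finset.sum_le_sum_of_subset (Finset.subset_univ _)

variable [IsProbabilityMeasure μ]

lemma integral_update (i : Fin n)
    {g : (Fin n → ℝ) → ℝ} (hg : Measurable g) (hg0 : ∀ v, 0 ≤ g v) (hg1 : ∀ v, g v ≤ 1) :
    ∫ v, ∫ b, g (Function.update v i b) ∂μ ∂(Measure.pi fun _ : Fin n => μ) =
      ∫ v, g v ∂(Measure.pi fun _ : Fin n => μ) := by
  rw [← integral_update' μ i hg hg0 hg1, integral_integral_swap]
  exact Integrable.of_bound (hg.comp (measurable_update_pair i)).aestronglyMeasurable 1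
      (ae_of_all _ fun q => by
        simp only [Function.uncurry]
        rw [Real.norm_of_nonneg (hg0 _)]; exact hg1 _)

/-- With the other values fixed, the winning bids of buyer `i` form an upper set whose infimum caps
the payment. The bound for upper sets is then averaged over the others. -/
lemma lintegral_vcg_pay_le (h0 : μ (Set.Iio 0) = 0) {A B : ℝ} (hA : 0 ≤ A)
    (h : ∀ v, 0 ≤ v → v * tail μ v ≤ A + B * tail μ v) (i : Fin n) :
    let p := (Measure.pi fun _ : Fin n => μ).real {v | rank v i < m}
    0 ≤ A + B * p ∧
    ∫⁻ v, ENNReal.ofReal ((vcg m n).pay v i) ∂(Measure.pi fun _ : Fin n => μ) ≤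
      ENNReal.ofReal (A + B * p) := by
  intro p
  have hnn : ∀ᵐ v ∂μ, 0 ≤ v := by
    rw [ae_iff]; simp only [not_le]; exact h0
  set g : (Fin n → ℝ) → ℝ := {v | rank v i < m}.indicator 1 with hg
  have hgm : Measurable g := measurable_one.indicator (measurableSet_rank_lt m i)
  have hg0 : ∀ v, 0 ≤ g v := fun v => Set.indicator_nonneg (fun _ _ => zero_le_one) v
  have hg1 : ∀ v, g v ≤ 1 := fun v => Set.indicator_le_self' (fun _ _ => zero_le_one) v
  have hp : p = ∫ v, g v ∂(Measure.pi fun _ : Fin n => μ) :=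
    (integral_indicator_one (measurableSet_rank_lt m i)).symm
  set U : (Fin n → ℝ) → Set ℝ := fun v => {b | 0 ≤ b ∧ rank (Function.update v i b) i < m} with hU
  have hUm : ∀ v, MeasurableSet (U v) := fun v => measurableSet_Ici.inter
    ((measurable_update_pair i).comp measurable_prodMk_left (measurableSet_rank_lt m i))
  have hUup : ∀ v, ∀ x ∈ U v, ∀ y, x ≤ y → y ∈ U v := fun v x hx y hxy =>
    ⟨hx.1.trans hxy, (rank_update_anti v i hxy).trans_lt hx.2⟩
  have hUg : ∀ v, μ.real (U v) = ∫ b, g (Function.update v i b) ∂μ := fun v => by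
    rw [← integral_indicator_one (hUm v)]
    refine integral_congr_ae ?_
    filter_upwards [hnn] with b hb
    simp [Set.indicator, hU, hg, hb]
  have key := fun v => mul_measure_le_of_isUpper hA h (U := U v) (fun b hb => hb.1) (hUup v)
  have hUi : Integrable (fun v => μ.real (U v)) (Measure.pi fun _ : Fin n => μ) := by
    refine Integrable.of_bound ?_ 1 (ae_of_all _ fun v => ?_)
    · simp only [hUg]
      have hsm : StronglyMeasurable
          (fun q : (Fin n → ℝ) × ℝ => g (Function.update q.1 i q.2)) :=
        (hgm.comp (measurable_update_pair i)).stronglyMeasurable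
      exact hsm.integral_prod_right.aestronglyMeasurable
    · rw [Real.norm_of_nonneg measureReal_nonneg]; exact measureReal_le_one
  have hint : ∫ v, A + B * μ.real (U v) ∂(Measure.pi fun _ : Fin n => μ) = A + B * p := by
    rw [integral_add (integrable_const A) (hUi.const_mul B), integral_const_mul, hp,
      ← integral_update i hgm hg0 hg1]
    simp [hUg]
  refine ⟨by rw [← hint]; exact integral_nonneg fun v => (key v).1, ?_⟩
  rw [← lintegral_update μ i (measurable_vcg_pay m i).ennreal_ofReal, ← hint,
    ofReal_integral_eq_lintegral_ofReal (f := fun v => A + B * μ.real (U v))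
      ((integrable_const A).add (hUi.const_mul B)) (ae_of_all _ fun v => (key v).1)]
  refine lintegral_mono fun v => ?_
  set c : ℝ≥0∞ := ⨅ b ∈ U v, ENNReal.ofReal b with hc
  refine le_trans ?_ ((key v).2 c fun b hb => iInf₂_le b hb)
  rw [← lintegral_indicator_const (hUm v)]
  refine lintegral_mono_ae ?_
  filter_upwards [hnn] with b hb
  by_cases hw : rank (Function.update v i b) i < m
  · rw [Set.indicator_of_mem (show b ∈ U v from ⟨hb, hw⟩)]
    simp only [vcg, if_pos hw]
    exact le_iInf₂ fun b' hb' =>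
      ENNReal.ofReal_le_ofReal (nextHighest_update_le hb'.1 hw hb'.2)
  · simp [vcg, if_neg hw]

/-- Exactly `m` buyers win, so `B` may have either sign, unlike in `optRevenue_le`. Tangents to the
right of the monopoly quantile have negative slope and are needed for the lower bound. -/
lemma vcgRevenue_le (h0 : μ (Set.Iio 0) = 0) (hmn : m ≤ n) {A B : ℝ} (hA : 0 ≤ A)
    (h : ∀ v, 0 ≤ v → v * tail μ v ≤ A + B * tail μ v) :
    vcgRevenue m n μ ≤ ENNReal.ofReal (n * A + m * B) := by
  rw [vcgRevenue, Mechanism.revenue,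
    lintegral_finsetSum _ fun i _ => (measurable_vcg_pay m i).ennreal_ofReal]
  refine (Finset.sum_le_sum fun i _ => (lintegral_vcg_pay_le h0 hA h i).2).trans ?_
  rw [← ENNReal.ofReal_sum_of_nonneg fun i _ => (lintegral_vcg_pay_le h0 hA h i).1]
  refine ENNReal.ofReal_le_ofReal (le_of_eq ?_)
  rw [Finset.sum_add_distrib, ← Finset.mul_sum]
  have hs : ∑ i, (Measure.pi fun _ : Fin n => μ).real {v | rank v i < m} = m := by
    have e : ∀ i, (Measure.pi fun _ : Fin n => μ).real {v | rank v i < m} =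
        ∫ v, {v | rank v i < m}.indicator 1 v ∂(Measure.pi fun _ : Fin n => μ) := fun i =>
      (integral_indicator_one (measurableSet_rank_lt m i)).symm
    simp only [e]
    rw [← integral_finsetSum]
    · have : ∀ v : Fin n → ℝ, ∑ i, {v | rank v i < m}.indicator (1 : (Fin n → ℝ) → ℝ) v = m :=
        fun v => by
          conv_rhs => rw [← card_rank_lt v hmn]
          simp [Set.indicator]
      simp [this]
    · exact fun i _ => (integrable_const (1 : ℝ)).indicator (measurableSet_rank_lt m i)
  rw [hs]
  simp [mul_comm]

end VCG

/-! ### Concentration of the number of buyers above a price -/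

section Concentration

variable (n : ℕ) (μ : Measure ℝ) [IsProbabilityMeasure μ] (c : ℝ)

/-- The number of buyers with value at least `c`. -/
def countAbove {n : ℕ} (c : ℝ) (v : Fin n → ℝ) : ℕ := (Finset.univ.filter fun j => c ≤ v j).card

lemma countAbove_eq_sum (v : Fin n → ℝ) :
    (countAbove c v : ℝ) = ∑ i, (Set.Ici c).indicator (1 : ℝ → ℝ) (v i) := by
  simp [countAbove, Set.indicator]

lemma measurable_countAbove : Measurable fun v : Fin n → ℝ => countAbove c v := by
  simp only [countAbove, Finset.card_filter]
  exact Finset.measurable_fun_sum _ fun j _ => Measurable.ite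
    (measurableSet_le measurable_const (measurable_pi_apply j)) measurable_const measurable_const

lemma memLp_countAbove :
    MemLp (fun v : Fin n → ℝ => (countAbove c v : ℝ)) 2 (Measure.pi fun _ : Fin n => μ) := by
  refine MemLp.of_bound
    (measurable_from_nat.comp (measurable_countAbove n c)).aestronglyMeasurable n
    (ae_of_all _ fun v => ?_)
  simp only [Real.norm_natCast, Nat.cast_le]
  exact (Finset.card_le_univ _).trans (by simp)

lemma integral_countAbove :
    ∫ v, (countAbove c v : ℝ) ∂(Measure.pi fun _ : Fin n => μ) = n * tail μ c := by
  have hm : Measurable ((Set.Ici c).indicator (1 : ℝ → ℝ)) :=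
    measurable_one.indicator measurableSet_Ici
  have hb : ∀ x, ‖(Set.Ici c).indicator (1 : ℝ → ℝ) x‖ ≤ 1 := fun x => by
    by_cases h : x ∈ Set.Ici c <;> simp [h]
  simp only [countAbove_eq_sum]
  rw [integral_finsetSum]
  · have : ∀ i : Fin n, ∫ v : Fin n → ℝ, (Set.Ici c).indicator (1 : ℝ → ℝ) (v i)
        ∂(Measure.pi fun _ : Fin n => μ) = tail μ c := fun i => by
      rw [integral_comp_eval (i := i) (μ := fun _ : Fin n => μ) hm.aestronglyMeasurable,
        integral_indicator_one measurableSet_Ici]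
      rfl
    simp [this]
  · exact fun i _ => Integrable.of_bound
      (hm.comp (measurable_pi_apply i)).aestronglyMeasurable 1 (ae_of_all _ fun v => hb _)

lemma variance_countAbove_le :
    ProbabilityTheory.variance (fun v : Fin n → ℝ => (countAbove c v : ℝ))
      (Measure.pi fun _ : Fin n => μ) ≤ n := by
  have hm : Measurable ((Set.Ici c).indicator (1 : ℝ → ℝ)) :=
    measurable_one.indicator measurableSet_Ici
  have hb : ∀ x, (Set.Ici c).indicator (1 : ℝ → ℝ) x ∈ Set.Icc (0 : ℝ) 1 := fun x => by
    by_cases h : x ∈ Set.Ici c <;> simp [h]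
  have e : (fun v : Fin n → ℝ => (countAbove c v : ℝ)) =
      ∑ i, fun v : Fin n → ℝ => (Set.Ici c).indicator (1 : ℝ → ℝ) (v i) := by
    ext v
    simp [countAbove_eq_sum]
  rw [e, ProbabilityTheory.variance_sum_pi
    (X := fun _ : Fin n => (Set.Ici c).indicator (1 : ℝ → ℝ))]
  · have h1 := ProbabilityTheory.variance_le_sq_of_bounded (μ := μ)
      (ae_of_all _ hb) hm.aemeasurable
    refine (Finset.sum_le_sum fun i _ => h1.trans (by norm_num : ((1 - 0) / 2 : ℝ) ^ 2 ≤ 1)).trans ?_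
    simp
  · exact fun i => MemLp.of_bound hm.aestronglyMeasurable 1 (ae_of_all _ fun x => by
      rw [Real.norm_of_nonneg (hb x).1]; exact (hb x).2)

lemma one_sub_le_measure_lt_countAbove {m : ℕ} (hm : m < n * tail μ c) :
    ENNReal.ofReal (1 - n / (n * tail μ c - m) ^ 2) ≤
      (Measure.pi fun _ : Fin n => μ) {v | m < countAbove c v} := by
  have hpos : 0 < n * tail μ c - m := sub_pos.2 hm
  have h1 := ProbabilityTheory.meas_ge_le_variance_div_sq (memLp_countAbove n μ c) hpos
  rw [integral_countAbove] at h1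
  have h2 : {v : Fin n → ℝ | m < countAbove c v}ᶜ ⊆
      {v | n * tail μ c - m ≤ |(countAbove c v : ℝ) - n * tail μ c|} := fun v hv => by
    simp only [Set.mem_compl_iff, Set.mem_ofPred_eq, not_lt] at hv ⊢
    have : (countAbove c v : ℝ) ≤ m := by exact_mod_cast hv
    rw [abs_sub_comm]
    exact le_trans (by linarith) (le_abs_self _)
  have hms : MeasurableSet {v : Fin n → ℝ | m < countAbove c v} :=
    measurable_countAbove n c (measurableSet_Ioi (a := m))
  have h3 := (measure_mono h2).trans h1
  rw [prob_compl_eq_one_sub hms] at h3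
  rw [ENNReal.ofReal_sub _ (by positivity), ENNReal.ofReal_one]
  refine tsub_le_iff_left.2 ?_
  have h4 := tsub_le_iff_right.1 h3
  refine h4.trans ?_
  gcongr
  exact variance_countAbove_le n μ c

lemma le_integral_min_countAbove {m : ℕ} (hm : n * tail μ c ≤ m) {ε : ℝ} (hε : 0 < ε)
    (hn : 0 < n) :
    n * tail μ c - ε * n - 1 / (4 * ε) ≤
      ∫ v, min (countAbove c v : ℝ) m ∂(Measure.pi fun _ : Fin n => μ) := by
  have hn' : (0 : ℝ) < n := by exact_mod_cast hn
  have hL := memLp_countAbove n μ c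
  have hS := hL.integrable one_le_two
  have hsq : Integrable (fun v : Fin n → ℝ => ((countAbove c v : ℝ) - n * tail μ c) ^ 2)
      (Measure.pi fun _ : Fin n => μ) := (hL.sub (memLp_const _)).integrable_sq
  have hvar := variance_countAbove_le n μ c
  rw [ProbabilityTheory.variance_eq_integral hS.aemeasurable, integral_countAbove] at hvar
  -- By AM-GM, `S - E ≤ ε n + (S - E)² / (4 ε n)` with `E = n * tail μ c ≤ m`. This replaces the
  -- truncation at `m` by a variance term.
  have hpt : ∀ v : Fin n → ℝ, (countAbove c v : ℝ) - ε * n -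
      ((countAbove c v : ℝ) - n * tail μ c) ^ 2 * (1 / (4 * ε * n)) ≤ min (countAbove c v : ℝ) m := by
    intro v
    set S := (countAbove c v : ℝ)
    have e : ε * n + (S - n * tail μ c) ^ 2 * (1 / (4 * ε * n)) - (S - n * tail μ c) =
        (S - n * tail μ c - 2 * (ε * n)) ^ 2 * (1 / (4 * ε * n)) := by
      field_simp; ring
    have h1 : 0 ≤ (S - n * tail μ c - 2 * (ε * n)) ^ 2 * (1 / (4 * ε * n)) := by positivity
    have h2 : 0 ≤ (S - n * tail μ c) ^ 2 * (1 / (4 * ε * n)) := by positivity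
    have h3 : 0 ≤ ε * n := by positivity
    refine le_min (by linarith) (by linarith)
  have hint1 : Integrable (fun v : Fin n → ℝ => (countAbove c v : ℝ) - ε * n)
    (Measure.pi fun _ : Fin n => μ) := hS.sub (integrable_const _)
  have hint2 := hsq.mul_const (1 / (4 * ε * n))
  refine le_trans ?_ (integral_mono (hint1.sub hint2) ?_ hpt)
  · simp only [Pi.sub_apply]
    rw [integral_sub hint1 hint2, integral_sub hS (integrable_const _), integral_countAbove,
      integral_const, integral_mul_const]
    have : (∫ v, ((countAbove c v : ℝ) - n * tail μ c) ^ 2 ∂(Measure.pi fun _ : Fin n => μ)) *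
        (1 / (4 * ε * n)) ≤ n * (1 / (4 * ε * n)) := by gcongr
    have e : n * (1 / (4 * ε * n)) = 1 / (4 * ε) := by field_simp
    simp only [probReal_univ, one_smul]
    linarith
  · exact hS.inf (integrable_const _)

end Concentration

/-! ### Selling at a posted price with proportional rationing -/

section PostedPrice

variable {n : ℕ}

/-- The probability with which each buyer willing to pay `p` is served when `m` units are rationed
among them. -/
def rationing (m : ℕ) (p : ℝ) (b : Fin n → ℝ) : ℝ := min 1 (m / countAbove p b)

/-- Every buyer bidding at least `p` is offered a unit at price `p`, rationed proportionally. -/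
def postedPrice (m : ℕ) (p : ℝ) : Mechanism n where
  alloc b i := if p ≤ b i then rationing m p b else 0
  pay b i := if p ≤ b i then p * rationing m p b else 0

lemma rationing_nonneg (m : ℕ) (p : ℝ) (b : Fin n → ℝ) : 0 ≤ rationing m p b :=
  le_min zero_le_one (by positivity)

lemma rationing_le_one (m : ℕ) (p : ℝ) (b : Fin n → ℝ) : rationing m p b ≤ 1 := min_le_left _ _

lemma measurable_rationing (m : ℕ) (p : ℝ) :
    Measurable fun b : Fin n → ℝ => rationing m p b :=
  measurable_const.min (measurable_const.div
    (measurable_from_nat.comp (measurable_countAbove n p)))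

lemma countAbove_mul_rationing (m : ℕ) (p : ℝ) (b : Fin n → ℝ) :
    countAbove p b * rationing m p b = min (countAbove p b : ℝ) m := by
  rcases Nat.eq_zero_or_pos (countAbove p b) with h | h
  · simp [h]
  · have h' : (0 : ℝ) < countAbove p b := by exact_mod_cast h
    rw [rationing, mul_min_of_nonneg _ _ h'.le, mul_one, mul_div_cancel₀ _ h'.ne']

lemma rationing_update (m : ℕ) {p : ℝ} (v : Fin n → ℝ) (i : Fin n) {b : ℝ} (hb : p ≤ b) :
    rationing m p (Function.update v i b) = rationing m p (Function.update v i p) := by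
  have : countAbove p (Function.update v i b) = countAbove p (Function.update v i p) := by
    unfold countAbove
    congr 1
    ext k
    by_cases hk : k = i
    · subst hk; simp [hb]
    · simp [hk]
  rw [rationing, rationing, this]

lemma postedPrice_feasible (m : ℕ) {p : ℝ} (hp : 0 ≤ p) :
    (postedPrice m p : Mechanism n).Feasible m := by
  have hms : ∀ i : Fin n, MeasurableSet {b : Fin n → ℝ | p ≤ b i} := fun i =>
    measurableSet_le measurable_const (measurable_pi_apply i)
  refine ⟨fun i => Measurable.ite (hms i) (measurable_rationing m p) measurable_const,
    fun i => Measurable.ite (hms i) ((measurable_rationing m p).const_mul p) measurable_const,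
    fun b i => ?_, fun b i => ?_, fun b => ?_⟩
  · by_cases h : p ≤ b i <;> simp [postedPrice, h, rationing_nonneg, rationing_le_one]
  · by_cases h : p ≤ b i <;> simp [postedPrice, h, mul_nonneg hp (rationing_nonneg m p b)]
  · have : ∑ i, (postedPrice m p).alloc b i = countAbove p b * rationing m p b := by
      simp [postedPrice, countAbove, Finset.sum_ite]
    rw [this, countAbove_mul_rationing]
    exact min_le_right _ _

variable {μ : Measure ℝ} [IsProbabilityMeasure μ]

/-- The rationing factor does not depend on the own bid once that bid is at least `p`. Each buyer
thus faces one take-it-or-leave-it offer, from which incentive compatibility follows. -/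
lemma postedPrice_interim (m : ℕ) {p : ℝ} (hp : 0 ≤ p) (i : Fin n) :
    ∃ C, 0 ≤ C ∧ ∀ b,
      ((postedPrice m p : Mechanism n).interimAlloc μ i b = if p ≤ b then C else 0) ∧
      ((postedPrice m p : Mechanism n).interimPay μ i b =
        if p ≤ b then ENNReal.ofReal (p * C) else 0) := by
  refine ⟨∫ v, rationing m p (Function.update v i p) ∂(Measure.pi fun _ : Fin n => μ),
    integral_nonneg fun v => rationing_nonneg _ _ _, fun b => ?_⟩
  by_cases hb : p ≤ b
  · simp only [Mechanism.interimAlloc, Mechanism.interimPay, postedPrice, Function.update_self, hb,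
      if_true, rationing_update m _ i hb, true_and]
    rw [← integral_const_mul, ofReal_integral_eq_lintegral_ofReal]
    · have hm : Measurable fun v : Fin n → ℝ => p * rationing m p (Function.update v i p) :=
        ((measurable_rationing m p).comp
          ((measurable_update_pair i).comp measurable_prodMk_right)).const_mul p
      refine Integrable.of_bound hm.aestronglyMeasurable p (ae_of_all _ fun v => ?_)
      rw [Real.norm_of_nonneg (mul_nonneg hp (rationing_nonneg _ _ _))]
      exact mul_le_of_le_one_right hp (rationing_le_one _ _ _)
    · exact ae_of_all _ fun v => mul_nonneg hp (rationing_nonneg _ _ _)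
  · simp [Mechanism.interimAlloc, Mechanism.interimPay, postedPrice, hb]

lemma le_optRevenue {m : ℕ} {p : ℝ} (hp : 0 ≤ p) (hm : n * tail μ p ≤ m) {ε : ℝ} (hε : 0 < ε)
    (hn : 0 < n) :
    ENNReal.ofReal (p * (n * tail μ p - ε * n - 1 / (4 * ε))) ≤ optRevenue m n μ := by
  have hF := postedPrice_feasible (n := n) m hp
  have hB : (postedPrice m p : Mechanism n).BIC μ := fun i v b hv hb => by
    obtain ⟨C, hC, h⟩ := postedPrice_interim (n := n) (μ := μ) m hp i
    rw [(h b).1, (h b).2, (h v).1, (h v).2]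
    by_cases h1 : p ≤ b <;> by_cases h2 : p ≤ v <;> simp only [h1, h2, if_true, if_false]
    · exact le_rfl
    · simp only [mul_zero, ENNReal.ofReal_zero, add_zero, zero_add]
      exact ENNReal.ofReal_le_ofReal (mul_le_mul_of_nonneg_right (not_le.1 h2).le hC)
    · simp only [mul_zero, ENNReal.ofReal_zero, add_zero, zero_add]
      exact ENNReal.ofReal_le_ofReal (mul_le_mul_of_nonneg_right h2 hC)
    · exact le_rfl
  have hI : (postedPrice m p : Mechanism n).InterimIR μ := fun i v hv => by
    obtain ⟨C, hC, h⟩ := postedPrice_interim (n := n) (μ := μ) m hp i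
    rw [(h v).1, (h v).2]
    by_cases h2 : p ≤ v <;> simp only [h2, if_true, if_false]
    · exact ENNReal.ofReal_le_ofReal (mul_le_mul_of_nonneg_right h2 hC)
    · exact zero_le
  refine le_trans ?_ (show (postedPrice m p : Mechanism n).revenue μ ≤ optRevenue m n μ from
    le_iSup₂ (f := fun (M : Mechanism n) (_ : M.Feasible m ∧ M.BIC μ ∧ M.InterimIR μ) =>
      M.revenue μ) (postedPrice m p) ⟨hF, hB, hI⟩)
  have hmin : Measurable fun v : Fin n → ℝ => min (countAbove p v : ℝ) m :=
    (measurable_from_nat.comp (measurable_countAbove n p)).min measurable_const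
  have hsum : ∀ v : Fin n → ℝ, ∑ i, ENNReal.ofReal ((postedPrice m p).pay v i) =
      ENNReal.ofReal (p * min (countAbove p v : ℝ) m) := fun v => by
    rw [← ENNReal.ofReal_sum_of_nonneg fun i _ => hF.2.2.2.1 v i, ← countAbove_mul_rationing]
    congr 1
    simp only [postedPrice, countAbove, Finset.sum_ite, Finset.sum_const, nsmul_eq_mul]
    ring
  rw [Mechanism.revenue, lintegral_congr hsum, ← ofReal_integral_eq_lintegral_ofReal,
    integral_const_mul]
  · exact ENNReal.ofReal_le_ofReal
      (mul_le_mul_of_nonneg_left (le_integral_min_countAbove n μ p hm hε hn) hp)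
  · refine (Integrable.of_bound hmin.aestronglyMeasurable m (ae_of_all _ fun v => ?_)).const_mul p
    rw [Real.norm_of_nonneg (by positivity)]
    exact min_le_right _ _
  · exact ae_of_all _ fun v => by positivity

end PostedPrice

/-! ### Comparing the VCG auction with the optimal revenue -/

/-- The properties of value distributions used to bound the optimal revenue. -/
structure IsCurveRegular (W : ℝ → ℝ) (μ : Measure ℝ) : Prop where
  prob : IsProbabilityMeasure μ
  nonneg : μ (Set.Iio 0) = 0
  no_atom : ∀ v, 0 < μ (Set.Ioi v) → μ {v} = 0
  lines : HasSupportingLines W μ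

/-- The parameters of an affine upper bound for the revenue curve `q ↦ q * W q`. -/
structure CurveBound (W : ℝ → ℝ) (κ D : ℝ) : Prop where
  one : W 1 = 0
  intercept : 0 ≤ κ
  slope : 0 ≤ D
  le : ∀ q, 0 < q → q ≤ 1 → q * W q ≤ κ + D * q

/-- The supremum of the values with tail at least `θ` works, by left continuity of the tail. Two
inequalities are stated because `v₁` may carry an atom. -/
lemma exists_quantile {μ : Measure ℝ} [IsProbabilityMeasure μ] (h0 : μ (Set.Iio 0) = 0) {θ : ℝ}
    (hθ : 0 < θ) (hθ1 : θ ≤ 1) : ∃ v₁, 0 ≤ v₁ ∧ θ ≤ tail μ v₁ ∧ μ.real (Set.Ioi v₁) ≤ θ := by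
  set S := {v | θ ≤ tail μ v} with hS
  have h0S : (0 : ℝ) ∈ S := by
    rw [hS, Set.mem_ofPred_eq, tail_zero μ h0]; exact hθ1
  have hlim : Tendsto (tail μ) atTop (𝓝 0) := by
    have h1 : Tendsto (fun v : ℝ => μ (Set.Ici v)) atTop (𝓝 (μ (⋂ v : ℝ, Set.Ici v))) :=
      tendsto_measure_iInter_atTop (fun v => measurableSet_Ici.nullMeasurableSet)
        (fun a b h => Set.Ici_subset_Ici.2 h) ⟨0, measure_ne_top _ _⟩
    have h2 : (⋂ v : ℝ, Set.Ici v) = ∅ := Set.eq_empty_of_forall_notMem fun x hx => by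
      have := Set.mem_iInter.1 hx (x + 1)
      simp only [Set.mem_Ici] at this
      linarith
    rw [h2, measure_empty] at h1
    exact (ENNReal.tendsto_toReal ENNReal.zero_ne_top).comp h1
  have hb : BddAbove S := by
    obtain ⟨M, hM⟩ := (hlim.eventually (gt_mem_nhds hθ)).exists
    exact ⟨M, fun v hv => by
      by_contra! h
      exact absurd hM (not_lt.2 (hv.trans (tail_anti μ h.le)))⟩
  refine ⟨sSup S, le_csSup hb h0S, ?_, ?_⟩
  · obtain ⟨u, hu, hlim', huS⟩ := exists_seq_tendsto_sSup ⟨0, h0S⟩ hb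
    have h1 := tendsto_measure_iInter_atTop (μ := μ) (s := fun k => Set.Ici (u k))
      (fun v => measurableSet_Ici.nullMeasurableSet)
      (fun a b h => Set.Ici_subset_Ici.2 (hu h)) ⟨0, measure_ne_top _ _⟩
    have h2 : (⋂ k, Set.Ici (u k)) = Set.Ici (sSup S) := by
      ext x
      simp only [Set.mem_iInter, Set.mem_Ici]
      exact ⟨fun h => le_of_tendsto' hlim' h, fun h k => (le_csSup hb (huS k)).trans h⟩
    rw [h2] at h1
    exact ge_of_tendsto' ((ENNReal.tendsto_toReal (measure_ne_top _ _)).comp h1) fun k => huS k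
  · set z : ℕ → ℝ := fun k => sSup S + 1 / (k + 1)
    have hz : ∀ k, sSup S < z k := fun k => by
      simp only [z]
      have : (0 : ℝ) < 1 / (k + 1) := by positivity
      linarith
    have hU : Set.Ioi (sSup S) = ⋃ k, Set.Ici (z k) := by
      ext x
      simp only [Set.mem_Ioi, Set.mem_iUnion, Set.mem_Ici]
      constructor
      · intro h
        obtain ⟨k, hk⟩ := exists_nat_one_div_lt (sub_pos.2 h)
        exact ⟨k, by simp only [z]; linarith⟩
      · rintro ⟨k, hk⟩
        exact (hz k).trans_le hk
    have hm : Monotone fun k => Set.Ici (z k) := fun i j hij => Set.Ici_subset_Ici.2 (by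
      simp only [z]
      gcongr)
    have h1 := tendsto_measure_iUnion_atTop (μ := μ) hm
    rw [← hU] at h1
    refine le_of_tendsto' ((ENNReal.tendsto_toReal (measure_ne_top _ _)).comp h1) fun k => ?_
    have : z k ∉ S := fun h => not_le.2 (hz k) (le_csSup hb h)
    exact (not_le.1 this).le

/-- The optimal revenue is controlled by the value at the quantile `θ`. -/
lemma exists_optRevenue_le {W : ℝ → ℝ} {μ : Measure ℝ} (hμ : IsCurveRegular W μ) {κ D θ : ℝ}
    (hW : CurveBound W κ D) (hθ : 0 < θ) (hθ1 : θ < 1) (hWθ : 0 < W θ) :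
    ∃ v₁, 0 ≤ v₁ ∧ θ ≤ tail μ v₁ ∧ ∀ m n : ℕ,
      optRevenue m n μ ≤ ENNReal.ofReal (v₁ * max (m : ℝ) ((n * κ + m * D) / W θ)) := by
  have := hμ.prob
  obtain ⟨v₁, hv₁, ht, htail⟩ := exists_quantile hμ.nonneg hθ hθ1.le
  refine ⟨v₁, hv₁, ht, fun m n => ?_⟩
  -- At the top of the support no supporting line is available and an atom is possible. But values
  -- then almost surely do not exceed `v₁`, and `A = 0`, `B = v₁` suffice.
  rcases eq_or_ne (μ (Set.Ioi v₁)) 0 with htop | htop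
  · refine (optRevenue_le hμ.nonneg le_rfl hv₁ fun v hv => ?_).trans
      (ENNReal.ofReal_le_ofReal (q := v₁ * max (m : ℝ) ((n * κ + m * D) / W θ)) ?_)
    · rcases le_or_gt v v₁ with h | h
      · rw [zero_add]
        exact mul_le_mul_of_nonneg_right h (tail_nonneg _ _)
      · have : tail μ v = 0 := by
          rw [tail, measureReal_def, measure_mono_null (Set.Ici_subset_Ioi.2 h) htop]
          rfl
        simp [this]
    · rw [mul_zero, zero_add, mul_comm]
      exact mul_le_mul_of_nonneg_left (le_max_left _ _) hv₁
  · have hpos : 0 < μ (Set.Ioi v₁) := pos_iff_ne_zero.2 htop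
    have hteq : tail μ v₁ = θ := by
      refine le_antisymm ?_ ht
      rw [tail, ← Set.Ioi_insert]
      refine (measureReal_union_le {v₁} (Set.Ioi v₁)).trans ?_
      rw [measureReal_def, hμ.no_atom v₁ hpos]
      simpa using htail
    have hinner : v₁ ∈ innerRange μ := by
      refine ⟨pos_iff_ne_zero.2 fun h => ?_, hpos⟩
      have h1 := prob_compl_eq_one_sub (μ := μ) (measurableSet_Iio (a := v₁))
      rw [Set.compl_Iio, h, tsub_zero] at h1
      rw [tail, measureReal_def, h1] at hteq
      simp at hteq
      linarith
    obtain ⟨s, hs, hline⟩ := hμ.lines v₁ hinner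
    rw [hteq] at hline
    have hz := hline 0 (by rw [tail_zero μ hμ.nonneg]; exact one_pos)
    rw [tail_zero μ hμ.nonneg, hW.one] at hz
    have hws : W θ / s ≤ v₁ := by rw [div_le_iff₀ hs]; linarith
    have hDs : 0 ≤ D / s := div_nonneg hW.slope hs.le
    have hκs : 0 ≤ κ / s := div_nonneg hW.intercept hs.le
    -- This majorant is the supporting line multiplied by `q`, with `q * W q` replaced by `κ + D *
    -- q`. Its slope is nonnegative because `W θ ≤ s * v₁`.
    refine (optRevenue_le hμ.nonneg (A := κ / s) (B := v₁ - W θ / s + D / s) hκs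
      (by linarith) fun v hv => ?_).trans (ENNReal.ofReal_le_ofReal ?_)
    · rcases (tail_nonneg μ v).eq_or_lt with h | h
      · rw [← h]; simpa using hκs
      have h1 := hline v h
      have h2 := hW.le _ h (tail_le_one μ v)
      have h3 : s * (v * tail μ v) ≤ s * (v₁ * tail μ v) - W θ * tail μ v + (κ + D * tail μ v) := by
        nlinarith
      have e : κ / s + (v₁ - W θ / s + D / s) * tail μ v =
          (s * (v₁ * tail μ v) - W θ * tail μ v + (κ + D * tail μ v)) / s := by
        field_simp; ring
      rw [e, le_div_iff₀ hs]
      linarith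
    -- The unknown slope `s` cancels: `m ≤ G` is applied to the nonnegative `v₁ - W θ / s`, and `n κ
    -- + m D ≤ G * W θ` to the rest.
    · set G := max (m : ℝ) ((n * κ + m * D) / W θ) with hG
      have hG1 : (m : ℝ) ≤ G := le_max_left _ _
      have hG2 : n * κ + m * D ≤ G * W θ := by
        rw [← div_le_iff₀ hWθ]; exact le_max_right _ _
      have e : n * (κ / s) + m * (v₁ - W θ / s + D / s) =
          m * (v₁ - W θ / s) + (n * κ + m * D) / s := by field_simp; ring
      rw [e]
      calc m * (v₁ - W θ / s) + (n * κ + m * D) / s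
          ≤ G * (v₁ - W θ / s) + G * W θ / s := by
            gcongr
        _ = v₁ * G := by ring

/-- VCG with `⌈x n⌉` additional buyers reaches the fraction `Γ`. -/
lemma eventually_le_vcgRevenue {W : ℝ → ℝ} {κ D θ α Γ x : ℝ} (hα : 0 < α) (hΓ : 0 < Γ)
    (hΓ' : Γ < 1) (hW : CurveBound W κ D) (hθ : 0 < θ) (hθ1 : θ < 1) (hWθ : 0 < W θ)
    (hκ : Γ * (κ / α + D) < W θ) (hx : 0 ≤ x) (hxθ : α < (1 + x) * θ) (hα1 : α ≤ 1) :
    ∀ᶠ n : ℕ in atTop, ∀ μ, IsCurveRegular W μ →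
      ENNReal.ofReal Γ * optRevenue ⌈α * n⌉₊ n μ ≤ vcgRevenue ⌈α * n⌉₊ (n + ⌈x * n⌉₊) μ := by
  set η := (1 + x) * θ - α with hη
  have hη0 : 0 < η := sub_pos.2 hxθ
  -- `Γ` times the optimum is at most `ρ * m * v₁`, so a success probability of at least `ρ`
  -- suffices. The thresholds on `n` below do not involve `μ`, which gives uniformity over the
  -- class.
  set ρ := Γ * max 1 ((κ / α + D) / W θ) with hρ
  have hρ1 : ρ < 1 := by
    rw [hρ, mul_max_of_nonneg _ _ hΓ.le, mul_one, ← mul_div_assoc]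
    exact max_lt hΓ' ((div_lt_one hWθ).2 hκ)
  have hlim : Tendsto (fun n : ℕ => (2 + x) * 4 / η ^ 2 / (n : ℝ)) atTop (𝓝 0) :=
    tendsto_const_nhds.div_atTop tendsto_natCast_atTop_atTop
  filter_upwards [eventually_gt_atTop 0, hlim.eventually (gt_mem_nhds (sub_pos.2 hρ1)),
    tendsto_natCast_atTop_atTop.eventually (eventually_ge_atTop (2 / η))] with n hn hn1 hn2 μ hμ
  have := hμ.prob
  have hn0 : (0 : ℝ) < n := by exact_mod_cast hn
  have hn1' : (1 : ℝ) ≤ n := by exact_mod_cast hn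
  obtain ⟨v₁, hv₁, ht, hopt⟩ := exists_optRevenue_le hμ hW hθ hθ1 hWθ
  set m := ⌈α * n⌉₊ with hm
  set N := n + ⌈x * n⌉₊ with hN
  have hm1 : α * n ≤ m := Nat.le_ceil _
  have hm2 : (m : ℝ) < α * n + 1 := Nat.ceil_lt_add_one (by positivity)
  have hmn : m ≤ n := Nat.ceil_le.2 (mul_le_of_le_one_left hn0.le hα1)
  have hN1 : (1 + x) * n ≤ N := by
    have := Nat.le_ceil (x * n)
    rw [hN]; push_cast; linarith
  have hN2 : (N : ℝ) ≤ (2 + x) * n := by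
    have := Nat.ceil_lt_add_one (show 0 ≤ x * n by positivity)
    rw [hN]; push_cast; linarith
  have hm0 : (0 : ℝ) < m := lt_of_lt_of_le (by positivity) hm1
  have hdiff : η * n / 2 ≤ N * tail μ v₁ - m := by
    have h1 : (1 + x) * n * θ ≤ N * tail μ v₁ := by gcongr
    have h2 : 2 ≤ n * η := by rwa [div_le_iff₀ hη0] at hn2
    have h3 : η * n = (1 + x) * n * θ - α * n := by rw [hη]; ring
    linarith
  have hprob : ρ ≤ 1 - N / (N * tail μ v₁ - m) ^ 2 := by
    have h1 : N / (N * tail μ v₁ - m) ^ 2 ≤ (2 + x) * n / (η * n / 2) ^ 2 := by gcongr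
    have h2 : (2 + x) * n / (η * n / 2) ^ 2 = (2 + x) * 4 / η ^ 2 / (n : ℝ) := by
      field_simp; ring
    linarith
  have hρ0 : 0 ≤ ρ := mul_nonneg hΓ.le (zero_le_one.trans (le_max_left _ _))
  have hmax : max (m : ℝ) ((n * κ + m * D) / W θ) ≤ m * max 1 ((κ / α + D) / W θ) := by
    rw [mul_max_of_nonneg _ _ hm0.le, mul_one, ← mul_div_assoc]
    gcongr
    have h1 : n * κ ≤ m * (κ / α) := by
      have := mul_le_mul_of_nonneg_right hm1 (div_nonneg hW.intercept hα.le)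
      have e : α * n * (κ / α) = n * κ := by field_simp
      linarith
    rw [mul_add]
    linarith
  calc ENNReal.ofReal Γ * optRevenue m n μ
      ≤ ENNReal.ofReal Γ * ENNReal.ofReal (v₁ * (m * max 1 ((κ / α + D) / W θ))) := by
        gcongr
        exact (hopt m n).trans (ENNReal.ofReal_le_ofReal (mul_le_mul_of_nonneg_left hmax hv₁))
    _ = ENNReal.ofReal v₁ * m * ENNReal.ofReal ρ := by
        rw [← ENNReal.ofReal_natCast m, ← ENNReal.ofReal_mul hΓ.le, ← ENNReal.ofReal_mul hv₁,
          ← ENNReal.ofReal_mul (by positivity)]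
        congr 1
        rw [hρ]; ring
    _ ≤ ENNReal.ofReal v₁ * m * ENNReal.ofReal (1 - N / (N * tail μ v₁ - m) ^ 2) := by
        gcongr
    _ ≤ ENNReal.ofReal v₁ * m * (Measure.pi fun _ : Fin N => μ) {v | m < countAbove v₁ v} := by
        gcongr
        refine one_sub_le_measure_lt_countAbove N μ v₁ ?_
        have : 0 < η * n / 2 := by positivity
        linarith
    _ ≤ vcgRevenue m N μ := le_vcgRevenue (hmn.trans (Nat.le_add_right _ _)) v₁

/-- VCG with at most `x n` buyers falls short of the fraction `Γ`. -/
lemma eventually_lt_of_le_vcgRevenue {μ : Measure ℝ} [IsProbabilityMeasure μ]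
    (h0 : μ (Set.Iio 0) = 0) {α Γ x p A B : ℝ} (hα : 0 < α) (hα1 : α ≤ 1) (hΓ : 0 < Γ) (hp : 0 < p)
    (htα : tail μ p ≤ α) (hA : 0 ≤ A) (h : ∀ v, 0 ≤ v → v * tail μ v ≤ A + B * tail μ v)
    (hx : x * A + α * B < Γ * (p * tail μ p)) :
    ∀ᶠ n : ℕ in atTop, ∀ k : ℕ,
      ENNReal.ofReal Γ * optRevenue ⌈α * n⌉₊ n μ ≤ vcgRevenue ⌈α * n⌉₊ (n + k) μ →
      x * n < n + k := by
  set gap := Γ * (p * tail μ p) - (x * A + α * B) with hgap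
  have hgap0 : 0 < gap := sub_pos.2 hx
  -- The loss `Γ p ε n` of the posted-price bound then uses half of `gap * n`; the other half
  -- absorbs the rounding of `m` and the constant term.
  set ε := gap / (2 * Γ * p) with hε
  have hε0 : 0 < ε := by positivity
  have hΓε : Γ * p * ε = gap / 2 := by rw [hε]; field_simp
  filter_upwards [eventually_gt_atTop 0, (tendsto_natCast_atTop_atTop (R := ℝ)).eventually
    (eventually_gt_atTop ((|B| + Γ * p * (1 / (4 * ε))) / (gap / 2)))] with n hn hn1 k hk
  rw [div_lt_iff₀ (by positivity)] at hn1
  have hn0 : (0 : ℝ) < n := by exact_mod_cast hn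
  set m := ⌈α * n⌉₊ with hm
  have hm1 : α * n ≤ m := Nat.le_ceil _
  have hm2 : (m : ℝ) < α * n + 1 := Nat.ceil_lt_add_one (by positivity)
  have hmn : m ≤ n := Nat.ceil_le.2 (mul_le_of_le_one_left hn0.le hα1)
  by_contra! hcon
  have hopt := le_optRevenue (n := n) (μ := μ) (m := m) hp.le
    (le_trans (by rw [mul_comm]; gcongr) hm1) hε0 hn
  have hvcg := vcgRevenue_le (n := n + k) (m := m) h0 (by omega) hA h
  have h1 := (mul_le_mul' (le_refl (ENNReal.ofReal Γ)) hopt).trans (hk.trans hvcg)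
  rw [← ENNReal.ofReal_mul hΓ.le] at h1
  have hmB : m * B ≤ α * n * B + |B| := by
    have h2 : (m - α * n) * B ≤ 1 * |B| :=
      mul_le_mul_of_nonneg (by linarith) (le_abs_self B) (by linarith) (abs_nonneg B)
    linarith
  have hlt : ((n + k : ℕ) : ℝ) * A + m * B <
      Γ * (p * (n * tail μ p - ε * n - 1 / (4 * ε))) := by
    have h2 : ((n + k : ℕ) : ℝ) * A ≤ x * n * A := by
      push_cast
      gcongr
    have e : Γ * (p * (n * tail μ p - ε * n - 1 / (4 * ε))) =
        Γ * (p * tail μ p) * n - Γ * p * ε * n - Γ * p * (1 / (4 * ε)) := by ring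
    have e2 : gap * n = Γ * (p * tail μ p) * n - (x * n * A + α * n * B) := by rw [hgap]; ring
    rw [e, hΓε]
    linarith
  -- The majorant at price 0, where the tail is 1. It makes the VCG bound nonnegative even for
  -- negative `B`, so that the comparison of `ENNReal.ofReal` values can be inverted.
  have hAB : 0 ≤ A + B := by
    have := h 0 le_rfl
    rwa [tail_zero μ h0, zero_mul, mul_one] at this
  have hpos : 0 ≤ ((n + k : ℕ) : ℝ) * A + m * B := by
    have hNm : (m : ℝ) ≤ (n + k : ℕ) := by exact_mod_cast hmn.trans (Nat.le_add_right _ _)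
    have h2 := mul_le_mul_of_nonneg_right hNm hA
    have h3 := mul_nonneg (Nat.cast_nonneg (α := ℝ) m) hAB
    linarith
  exact not_le.2 hlt ((ENNReal.ofReal_le_ofReal_iff hpos).1 h1)

lemma hasAsymptoticCC_of_bounds {α Γ L : ℝ} {C : Set (Measure ℝ)} (hL : 0 ≤ L)
    (hU : ∀ x, L < x → ∀ᶠ n : ℕ in atTop, ∀ μ ∈ C,
      ENNReal.ofReal Γ * optRevenue ⌈α * n⌉₊ n μ ≤ vcgRevenue ⌈α * n⌉₊ (n + ⌈x * n⌉₊) μ)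
    (hLo : ∀ x, 0 < x → x < L → ∀ᶠ n : ℕ in atTop, ∀ k : ℕ, (∀ μ ∈ C,
      ENNReal.ofReal Γ * optRevenue ⌈α * n⌉₊ n μ ≤ vcgRevenue ⌈α * n⌉₊ (n + k) μ) →
        (1 + x) * n < n + k) :
    HasAsymptoticCC α C Γ L := by
  rw [HasAsymptoticCC, tendsto_order]
  constructor
  · intro a ha
    have hafin : a ≠ ⊤ := (ha.trans ENNReal.ofReal_lt_top).ne
    obtain ⟨x, hax, hxL⟩ := exists_between ((ENNReal.lt_ofReal_iff_toReal_lt hafin).1 ha)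
    have hx0 : 0 < x := ENNReal.toReal_nonneg.trans_lt hax
    filter_upwards [hLo x hx0 hxL, eventually_gt_atTop 0] with n hn hn0
    have hn0' : (0 : ℝ) < n := by exact_mod_cast hn0
    have h1 : ((⌈x * n⌉₊ : ℕ) : ℕ∞) ≤ competitionComplexity ⌈α * n⌉₊ n C Γ := by
      refine le_iInf₂ fun k hk => ?_
      have := hn k hk
      exact_mod_cast Nat.ceil_le.2 (by linarith)
    have h2 : ((⌈x * n⌉₊ : ℕ) : ℝ≥0∞) ≤ (competitionComplexity ⌈α * n⌉₊ n C Γ : ℝ≥0∞) := by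
      have := ENat.toENNReal_le.2 h1
      simpa using this
    refine ((ENNReal.lt_ofReal_iff_toReal_lt hafin).2 hax).trans_le ?_
    rw [ENNReal.le_div_iff_mul_le (Or.inl (by simpa using hn0.ne')) (Or.inl (by simp))]
    refine le_trans ?_ h2
    rw [← ENNReal.ofReal_natCast n, ← ENNReal.ofReal_mul hx0.le, ← ENNReal.ofReal_natCast ⌈x * n⌉₊]
    exact ENNReal.ofReal_le_ofReal (Nat.le_ceil _)
  · intro a ha
    obtain ⟨b, hLb, hba⟩ := exists_between ha
    have hbfin : b ≠ ⊤ := (hba.trans_le le_top).ne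
    have hLb' : L < b.toReal := (ENNReal.ofReal_lt_iff_lt_toReal hL hbfin).1 hLb
    obtain ⟨x, hLx, hxb⟩ := exists_between hLb'
    have hx0 : 0 < x := hL.trans_lt hLx
    filter_upwards [hU x hLx, eventually_gt_atTop 0,
      (tendsto_natCast_atTop_atTop (R := ℝ)).eventually
        (eventually_gt_atTop (1 / (b.toReal - x)))] with n hn hn0 hn1
    have hn0' : (0 : ℝ) < n := by exact_mod_cast hn0
    have h1 : competitionComplexity ⌈α * n⌉₊ n C Γ ≤ ((⌈x * n⌉₊ : ℕ) : ℕ∞) := iInf₂_le _ hn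
    have h2 : (competitionComplexity ⌈α * n⌉₊ n C Γ : ℝ≥0∞) ≤ ((⌈x * n⌉₊ : ℕ) : ℝ≥0∞) := by
      have := ENat.toENNReal_le.2 h1
      simpa using this
    refine lt_of_le_of_lt ?_ hba
    refine ENNReal.div_le_of_le_mul (h2.trans ?_)
    rw [← ENNReal.ofReal_toReal hbfin, ← ENNReal.ofReal_natCast n,
      ← ENNReal.ofReal_mul ENNReal.toReal_nonneg, ← ENNReal.ofReal_natCast ⌈x * n⌉₊]
    refine ENNReal.ofReal_le_ofReal ((Nat.ceil_lt_add_one (by positivity)).le.trans ?_)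
    rw [div_lt_iff₀ (sub_pos.2 hxb)] at hn1
    nlinarith

/-! ### Relations between the classes -/

lemma IsMonotoneDistribution.mono {φ ψ : ℝ → ℝ → ℝ → ℝ} {μ : Measure ℝ}
    (h : IsMonotoneDistribution φ μ)
    (hφ : ∀ v s d v' s' d' : ℝ, 0 < s → 0 < d → 0 < s' → 0 < d' → v ≤ v' →
      φ v s d ≤ φ v' s' d' → ψ v s d ≤ ψ v' s' d') : IsMonotoneDistribution ψ μ := by
  obtain ⟨hp, h0, f, hfm, hf, hpos, hm⟩ := h
  exact ⟨hp, h0, f, hfm, hf, hpos, fun a ha b hb hab => hφ _ _ _ _ _ _ (tail_pos_of_mem ha.2)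
    (hpos a ha) (tail_pos_of_mem hb.2) (hpos b hb) hab (hm ha hb hab)⟩

lemma regular_eq_lambdaRegular_one : regular = lambdaRegular 1 := by
  simp [regular, lambdaRegular]

lemma mhr_eq_lambdaRegular_zero : mhr = lambdaRegular 0 := by
  have key : ∀ {s d s' d' : ℝ}, 0 < s → 0 < d → 0 < s' → 0 < d' →
      (d / s ≤ d' / s' ↔ s' / d' ≤ s / d) := fun {s d s' d'} hs hd hs' hd' => by
    rw [div_le_div_iff₀ hs hs', div_le_div_iff₀ hd' hd, mul_comm d, mul_comm d']
  ext μ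
  constructor
  · intro h
    have h : IsMonotoneDistribution (fun _ s d => d / s) μ := h
    change IsMonotoneDistribution (fun v s d => 0 * v - s / d) μ
    refine h.mono fun v s d v' s' d' hs hd hs' hd' _ hle => ?_
    have := (key hs hd hs' hd').1 hle
    simpa using this
  · intro h
    have h : IsMonotoneDistribution (fun v s d => 0 * v - s / d) μ := h
    change IsMonotoneDistribution (fun _ s d => d / s) μ
    refine h.mono fun v s d v' s' d' hs hd hs' hd' _ hle => ?_
    exact (key hs hd hs' hd').2 (by simpa using hle)

lemma lambdaRegular_mono {lam lam' : ℝ} (h : lam ≤ lam') :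
    lambdaRegular lam ⊆ lambdaRegular lam' := fun μ hμ => by
  have hμ : IsMonotoneDistribution (fun v s d => lam * v - s / d) μ := hμ
  change IsMonotoneDistribution (fun v s d => lam' * v - s / d) μ
  refine hμ.mono fun v s d v' s' d' _ _ _ _ hv hle => ?_
  have := mul_le_mul_of_nonneg_left hv (sub_nonneg.2 h)
  linarith

lemma isCurveRegular_of_lambdaRegular {lam : ℝ} {μ : Measure ℝ} {W : ℝ → ℝ}
    (h : μ ∈ lambdaRegular lam) (hW : HasSupportingLines W μ) : IsCurveRegular W μ := by
  obtain ⟨hp, h0, f, -, hf, -⟩ := h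
  exact ⟨hp, h0, fun v hv => measure_singleton_eq_zero hf hv, hW⟩

/-! ### Revenue curves of constant virtual value -/

/-- The value at quantile `q` of the generalized Pareto distribution with constant
`lam`-virtual value. -/
def paretoValue (lam q : ℝ) : ℝ := (q ^ (-lam) - 1) / lam

/-- The right-hand side is the tangent at `β` to the concave revenue curve; weighted AM-GM for `q ^
(1 - lam) * β ^ lam` proves it. -/
lemma mul_paretoValue_le {lam β q : ℝ} (hlam : 0 < lam) (hlam1 : lam ≤ 1) (hβ : 0 < β)
    (hq : 0 < q) : q * paretoValue lam q ≤
      β ^ (1 - lam) + ((1 - lam) * β ^ (-lam) - 1) / lam * q := by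
  have h := Real.geom_mean_le_arith_mean2_weighted (sub_nonneg.2 hlam1) hlam.le hq.le hβ.le
    (by ring)
  have hβl : 0 < β ^ lam := Real.rpow_pos_of_pos hβ _
  have e1 : q ^ (1 - lam) = q * q ^ (-lam) := by
    rw [sub_eq_add_neg, Real.rpow_add hq, Real.rpow_one]
  have e2 : β ^ (1 - lam) = β * β ^ (-lam) := by
    rw [sub_eq_add_neg, Real.rpow_add hβ, Real.rpow_one]
  have e3 : β ^ lam * β ^ (-lam) = 1 := by rw [← Real.rpow_add hβ]; simp
  have hβn : 0 < β ^ (-lam) := Real.rpow_pos_of_pos hβ _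
  have h1 : q * q ^ (-lam) ≤ ((1 - lam) * q + lam * β) * β ^ (-lam) := by
    rw [← e1]
    calc q ^ (1 - lam) = q ^ (1 - lam) * β ^ lam * β ^ (-lam) := by rw [mul_assoc, e3, mul_one]
      _ ≤ _ := by gcongr
  rw [paretoValue, e2]
  have e4 : q * ((q ^ (-lam) - 1) / lam) = (q * q ^ (-lam) - q) / lam := by ring
  have e5 : β * β ^ (-lam) + ((1 - lam) * β ^ (-lam) - 1) / lam * q =
      (((1 - lam) * q + lam * β) * β ^ (-lam) - q) / lam := by field_simp; ring
  rw [e4, e5]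
  gcongr

lemma mul_neg_log_le {β q : ℝ} (hβ : 0 < β) (hq : 0 < q) :
    q * -Real.log q ≤ β + (-Real.log β - 1) * q := by
  have h := Real.log_le_sub_one_of_pos (div_pos hβ hq)
  rw [Real.log_div hβ.ne' hq.ne'] at h
  have h1 := mul_le_mul_of_nonneg_left h hq.le
  have e : q * (β / q - 1) = β - q := by field_simp
  rw [e] at h1
  linarith

lemma paretoValue_strictAnti {lam a b : ℝ} (hlam : 0 < lam) (ha : 0 < a) (hab : a < b) :
    paretoValue lam b < paretoValue lam a := by
  unfold paretoValue
  have : b ^ (-lam) < a ^ (-lam) := Real.rpow_lt_rpow_of_neg ha hab (by linarith)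
  gcongr

lemma paretoValue_one (lam : ℝ) : paretoValue lam 1 = 0 := by simp [paretoValue]

/-! ### Distributions of constant virtual value -/

/-- `μ` is the distribution with value `W q` at quantile `q`. -/
structure HasValueCurve (W : ℝ → ℝ) (μ : Measure ℝ) : Prop where
  prob : IsProbabilityMeasure μ
  nonneg : μ (Set.Iio 0) = 0
  tail_pos : ∀ v, 0 ≤ v → 0 < tail μ v
  value : ∀ v, 0 ≤ v → W (tail μ v) = v

namespace HasValueCurve

variable {W : ℝ → ℝ} {μ : Measure ℝ}

lemma mul_tail_le (h : HasValueCurve W μ) {A B : ℝ}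
    (hAB : ∀ q, 0 < q → q ≤ 1 → q * W q ≤ A + B * q) {v : ℝ} (hv : 0 ≤ v) :
    v * tail μ v ≤ A + B * tail μ v := by
  have := h.prob
  have h1 := hAB _ (h.tail_pos v hv) (tail_le_one μ v)
  rw [h.value v hv] at h1
  linarith

lemma measure_Ico_pos (h : HasValueCurve W μ) {a b : ℝ} (ha : 0 ≤ a) (hab : a < b) :
    0 < μ (Set.Ico a b) := by
  have := h.prob
  refine pos_iff_ne_zero.2 fun h0 => hab.ne ?_
  have h1 := tail_eq_add_Ico μ hab.le
  rw [measureReal_def, h0, ENNReal.toReal_zero, add_zero] at h1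
  rw [← h.value a ha, h1, h.value b (ha.trans hab.le)]

lemma measure_Ioi_pos (h : HasValueCurve W μ) (v : ℝ) : 0 < μ (Set.Ioi v) :=
  (h.measure_Ico_pos (a := max v 0 + 1) (b := max v 0 + 2)
    (by positivity) (by linarith)).trans_le (measure_mono fun x hx => by
      have := le_max_left v 0
      have := hx.1
      simp only [Set.mem_Ioi]
      linarith)

lemma innerRange_eq (h : HasValueCurve W μ) : innerRange μ = Set.Ioi 0 := by
  ext v
  refine ⟨fun hv => ?_, fun hv => ⟨?_, h.measure_Ioi_pos v⟩⟩
  · by_contra hc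
    exact hv.1.ne' (measure_mono_null (Set.Iio_subset_Iio (not_lt.1 hc)) h.nonneg)
  · exact (h.measure_Ico_pos le_rfl hv).trans_le (measure_mono fun x hx => hx.2)

lemma mem_support (h : HasValueCurve W μ) {p : ℝ} (hp : 0 ≤ p) : p ∈ μ.support := by
  rw [Measure.mem_support_iff_forall]
  intro U hU
  obtain ⟨ε, hε, hεU⟩ := Metric.mem_nhds_iff.1 hU
  refine (h.measure_Ico_pos hp (lt_add_of_pos_right p hε)).trans_le
    (measure_mono fun x hx => hεU ?_)
  rw [Metric.mem_ball, Real.dist_eq, abs_of_nonneg (sub_nonneg.2 hx.1)]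
  linarith [hx.2]

end HasValueCurve

/-- The condition `T v / f v = 1 + lam * v` makes the `lam`-virtual value constantly `-1`, hence
trivially monotone. -/
lemma exists_hasValueCurve {W T f : ℝ → ℝ} {lam : ℝ} (hfm : Measurable f)
    (hf : ∀ v, 0 ≤ v → 0 < f v) (hT : ∀ v, 0 ≤ v → HasDerivAt T (-f v) v) (hT0 : T 0 = 1)
    (hTlim : Tendsto T atTop (𝓝 0)) (hTpos : ∀ v, 0 ≤ v → 0 < T v)
    (hW : ∀ v, 0 ≤ v → W (T v) = v) (hTf : ∀ v, 0 < v → T v / f v = 1 + lam * v) :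
    ∃ μ ∈ lambdaRegular lam, HasValueCurve W μ ∧ μ ≪ volume ∧ ∀ v, 0 ≤ v → tail μ v = T v := by
  set g : ℝ → ℝ := (Set.Ici 0).indicator f with hg
  have hgm : Measurable g := hfm.indicator measurableSet_Ici
  set μ : Measure ℝ := volume.withDensity fun v => ENNReal.ofReal (g v) with hμ
  have hIci : ∀ v, 0 ≤ v → μ (Set.Ici v) = ENNReal.ofReal (T v) := fun v hv => by
    have hd : ∀ x ∈ Set.Ici v, HasDerivAt (fun x => -T x) (f x) x := fun x hx =>
      (hT x (hv.trans hx)).neg.congr_deriv (neg_neg _)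
    have hn : ∀ x ∈ Set.Ioi v, 0 ≤ f x := fun x hx => (hf x (hv.trans (le_of_lt hx))).le
    have hl : Tendsto (fun x => -T x) atTop (𝓝 0) := by simpa using hTlim.neg
    have hint := integrableOn_Ioi_deriv_of_nonneg' hd hn hl
    have hval := integral_Ioi_of_hasDerivAt_of_nonneg' hd hn hl
    rw [hμ, withDensity_apply _ measurableSet_Ici,
      ← Measure.restrict_congr_set (Ioi_ae_eq_Ici (a := v))]
    have e : ∫⁻ x in Set.Ioi v, ENNReal.ofReal (g x) = ∫⁻ x in Set.Ioi v, ENNReal.ofReal (f x) :=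
      setLIntegral_congr_fun measurableSet_Ioi fun x hx => by
        simp only [hg]
        rw [Set.indicator_of_mem (show x ∈ Set.Ici (0 : ℝ) from hv.trans (le_of_lt hx))]
    rw [e, ← ofReal_integral_eq_lintegral_ofReal hint
      ((ae_restrict_iff' measurableSet_Ioi).2 (ae_of_all _ hn)), hval]
    simp
  have hneg : μ (Set.Iio 0) = 0 := by
    rw [hμ, withDensity_apply _ measurableSet_Iio]
    have e : ∫⁻ x in Set.Iio (0 : ℝ), ENNReal.ofReal (g x) = ∫⁻ x in Set.Iio (0 : ℝ), 0 :=
      setLIntegral_congr_fun measurableSet_Iio fun x hx => by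
        simp only [hg]
        rw [Set.indicator_of_notMem (show x ∉ Set.Ici (0 : ℝ) from fun h => not_le.2 (Set.mem_Iio.1 hx) (Set.mem_Ici.1 h))]
        simp
    rw [e, lintegral_zero]
  have hprob : IsProbabilityMeasure μ := ⟨by
    rw [← Set.Iio_union_Ici (a := (0 : ℝ)), measure_union _ measurableSet_Ici, hneg, hIci 0 le_rfl,
      hT0]
    · simp
    · exact Set.disjoint_left.2 fun x hx hx' => not_le.2 (Set.mem_Iio.1 hx) hx'⟩
  have htail : ∀ v, 0 ≤ v → tail μ v = T v := fun v hv => by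
    rw [tail, measureReal_def, hIci v hv, ENNReal.toReal_ofReal (hTpos v hv).le]
  have hcurve : HasValueCurve W μ :=
    ⟨hprob, hneg, fun v hv => by rw [htail v hv]; exact hTpos v hv,
      fun v hv => by rw [htail v hv]; exact hW v hv⟩
  have huniv : {v | 0 < μ (Set.Ioi v)} = Set.univ :=
    Set.eq_univ_of_forall fun v => hcurve.measure_Ioi_pos v
  have hgf : ∀ v, 0 < v → g v = f v := fun v hv =>
    Set.indicator_of_mem (show v ∈ Set.Ici (0 : ℝ) from hv.le) f
  refine ⟨μ, ⟨hprob, hneg, g, hgm, ?_, fun v hv => ?_, fun a ha b hb hab => ?_⟩, hcurve,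
    withDensity_absolutelyContinuous _ _, htail⟩
  · rw [huniv, Measure.restrict_univ, Measure.restrict_univ]
  · rw [hcurve.innerRange_eq] at hv
    rw [hgf v hv]
    exact hf v (le_of_lt hv)
  · rw [hcurve.innerRange_eq] at ha hb
    simp only [htail a (le_of_lt ha), htail b (le_of_lt hb), hgf a ha, hgf b hb, hTf a ha, hTf b hb]
    linarith

lemma exists_pareto {lam : ℝ} (hlam : 0 < lam) :
    ∃ μ ∈ lambdaRegular lam, HasValueCurve (paretoValue lam) μ ∧ μ ≪ volume ∧
      ∀ v, 0 ≤ v → tail μ v = (1 + lam * v) ^ (-(1 / lam)) := by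
  have hpos : ∀ v, 0 ≤ v → 0 < 1 + lam * v := fun v hv => by positivity
  refine exists_hasValueCurve (f := fun v => (1 + lam * v) ^ (-(1 / lam) - 1)) ?_ ?_ ?_ ?_ ?_ ?_ ?_ ?_
  · exact (measurable_const.add (measurable_id.const_mul lam)).pow_const _
  · exact fun v hv => Real.rpow_pos_of_pos (hpos v hv) _
  · intro v hv
    have h1 : HasDerivAt (fun v => 1 + lam * v) lam v := by
      simpa using ((hasDerivAt_id v).const_mul lam).const_add 1
    refine (h1.rpow_const (p := -(1 / lam)) (Or.inl (hpos v hv).ne')).congr_deriv ?_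
    field_simp
  · simp
  · exact (tendsto_rpow_neg_atTop (by positivity)).comp
      (tendsto_atTop_add_const_left _ _ (tendsto_id.const_mul_atTop hlam))
  · exact fun v hv => Real.rpow_pos_of_pos (hpos v hv) _
  · intro v hv
    rw [paretoValue, ← Real.rpow_mul (hpos v hv).le]
    have : -(1 / lam) * -lam = 1 := by field_simp
    rw [this, Real.rpow_one]
    field_simp
    ring
  · intro v hv
    rw [← Real.rpow_sub (hpos v hv.le)]
    have : -(1 / lam) - (-(1 / lam) - 1) = 1 := by ring
    rw [this, Real.rpow_one]

lemma exists_exponential :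
    ∃ μ ∈ lambdaRegular 0, HasValueCurve (fun q => -Real.log q) μ ∧ μ ≪ volume ∧
      ∀ v, 0 ≤ v → tail μ v = Real.exp (-v) := by
  refine exists_hasValueCurve (f := fun v => Real.exp (-v)) ?_ ?_ ?_ ?_ ?_ ?_ ?_ ?_
  · exact Real.measurable_exp.comp measurable_neg
  · exact fun v _ => Real.exp_pos _
  · intro v _
    simpa using (hasDerivAt_neg v).exp
  · simp
  · exact Real.tendsto_exp_neg_atTop_nhds_zero
  · exact fun v _ => Real.exp_pos _
  · intro v _
    simp
  · intro v _
    simp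

/-- If the revenue curve `q ↦ q * W q` is maximal at `q₀ ≤ α` and lies below an affine function
whose value at `α / (1 + x)` is small, then VCG needs more than `x n` additional buyers. -/
lemma eventually_lt_of_hasValueCurve {W : ℝ → ℝ} {μ : Measure ℝ} (hμ : HasValueCurve W μ)
    (hac : μ ≪ volume) {C D : Set (Measure ℝ)} (hC : μ ∈ C) (hD : densityWithMonopolyPrice ⊆ D)
    {α Γ x q₀ K A B : ℝ} (hα : 0 < α) (hα1 : α ≤ 1) (hΓ : 0 < Γ) (hq₀α : q₀ ≤ α)
    (hWq₀ : 0 < W q₀) (htail : tail μ (W q₀) = q₀) (hK : q₀ * W q₀ = K)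
    (hmax : ∀ q, 0 < q → q ≤ 1 → q * W q ≤ K) (hA : 0 ≤ A)
    (hAB : ∀ q, 0 < q → q ≤ 1 → q * W q ≤ A + B * q)
    (hx : (1 + x) * A + α * B < Γ * K) :
    ∀ᶠ n : ℕ in atTop, ∀ k : ℕ, (∀ μ ∈ C ∩ D,
      ENNReal.ofReal Γ * optRevenue ⌈α * n⌉₊ n μ ≤ vcgRevenue ⌈α * n⌉₊ (n + k) μ) →
        (1 + x) * n < n + k := by
  have := hμ.prob
  have hpt : W q₀ * tail μ (W q₀) = K := by rw [htail, mul_comm, hK]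
  have hmem : μ ∈ C ∩ D := by
    refine ⟨hC, hD ⟨hac, W q₀, hμ.mem_support hWq₀.le, fun p' => ?_⟩⟩
    rw [hpt]
    rcases le_total 0 p' with hp | hp
    · simpa using hμ.mul_tail_le (A := K) (B := 0) (by simpa using hmax) hp
    · refine (mul_nonpos_of_nonpos_of_nonneg hp (tail_nonneg _ _)).trans ?_
      rw [← hpt]
      exact mul_nonneg hWq₀.le (tail_nonneg _ _)
  filter_upwards [eventually_lt_of_le_vcgRevenue hμ.nonneg hα hα1 hΓ hWq₀ (htail.trans_le hq₀α) hA
    (fun v hv => hμ.mul_tail_le hAB hv) (by rwa [hpt])] with n hn k hk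
  exact hn k (hk μ hmem)

/-! ### The competition complexity of the classes -/

/-- The maximum of the revenue curve `q ↦ q * paretoValue lam q`. -/
def paretoRevenue (lam : ℝ) : ℝ := (1 - lam) ^ ((1 - lam) / lam)

/-- The factor by which the ratio of demand to supply has to grow. -/
def paretoGrowth (lam α Γ : ℝ) : ℝ := (lam * Γ / α * paretoRevenue lam + 1) ^ (1 / lam)

lemma paretoRevenue_pos {lam : ℝ} (hlam1 : lam ≤ 1) : 0 < paretoRevenue lam := by
  rcases hlam1.lt_or_eq with h | rfl
  · exact Real.rpow_pos_of_pos (sub_pos.2 h) _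
  · simp [paretoRevenue]

lemma monopolyQuantile_mul {lam : ℝ} (hlam : 0 < lam) (hlam1 : lam < 1) :
    paretoValue lam ((1 - lam) ^ (1 / lam)) = 1 / (1 - lam) ∧
      (1 - lam) ^ (1 / lam) * paretoValue lam ((1 - lam) ^ (1 / lam)) = paretoRevenue lam := by
  have h1 : 0 < 1 - lam := sub_pos.2 hlam1
  have e : paretoValue lam ((1 - lam) ^ (1 / lam)) = 1 / (1 - lam) := by
    rw [paretoValue, ← Real.rpow_mul h1.le]
    have : 1 / lam * -lam = -1 := by field_simp
    rw [this, Real.rpow_neg_one]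
    field_simp
    ring
  refine ⟨e, ?_⟩
  have e2 : (1 - lam) / lam = 1 / lam - 1 := by field_simp
  rw [e, paretoRevenue, e2, Real.rpow_sub h1, Real.rpow_one, mul_one_div]

/-- For `lam < 1` the tangent at the monopoly quantile is horizontal. For `lam = 1` the curve is `1
- q`, whose supremum 1 is not attained. -/
lemma mul_paretoValue_le_paretoRevenue {lam : ℝ} (hlam : 0 < lam) (hlam1 : lam ≤ 1) {q : ℝ}
    (hq : 0 < q) : q * paretoValue lam q ≤ paretoRevenue lam := by
  rcases hlam1.lt_or_eq with h | rfl
  · have h1 : 0 < 1 - lam := sub_pos.2 h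
    have := mul_paretoValue_le hlam hlam1 (Real.rpow_pos_of_pos h1 (1 / lam)) hq
    have e1 : 1 / lam * -lam = -1 := by field_simp
    have e2 : 1 / lam * (1 - lam) = (1 - lam) / lam := by ring
    rw [← Real.rpow_mul h1.le, ← Real.rpow_mul h1.le, e1, e2, Real.rpow_neg_one,
      mul_inv_cancel₀ h1.ne', sub_self, zero_div, zero_mul, add_zero] at this
    exact this
  · have : q * paretoValue 1 q = 1 - q := by
      rw [paretoValue, Real.rpow_neg_one]
      field_simp
    rw [this, paretoRevenue]
    simp [hq.le]

/-- Solving `W θ = Γ K / α` gives `θ = 1 / paretoGrowth lam α Γ`; the critical `x` has `α / (1 + x)`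
equal to this `θ`. -/
lemma paretoValue_inv_paretoGrowth {lam α Γ : ℝ} (hlam : 0 < lam) (hlam1 : lam ≤ 1) (hα : 0 < α)
    (hΓ : 0 < Γ) : 1 < paretoGrowth lam α Γ ∧
      paretoValue lam (1 / paretoGrowth lam α Γ) = Γ * paretoRevenue lam / α := by
  have hK := paretoRevenue_pos hlam1
  have hp : 0 < lam * Γ / α * paretoRevenue lam := by positivity
  have h1 : 1 < paretoGrowth lam α Γ := Real.one_lt_rpow (by linarith) (by positivity)
  refine ⟨h1, ?_⟩
  have h0 : 0 < paretoGrowth lam α Γ := zero_lt_one.trans h1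
  rw [paretoValue, one_div, Real.inv_rpow h0.le, Real.rpow_neg h0.le, inv_inv, paretoGrowth,
    ← Real.rpow_mul (by linarith), one_div_mul_cancel hlam.ne', Real.rpow_one]
  field_simp
  ring

section

variable {α Γ : ℝ}

lemma eventually_le_of_lambdaRegular {lam x : ℝ} (hα : 0 < α) (hα1 : α ≤ 1) (hΓ : 0 < Γ)
    (hΓ1 : Γ < 1) (hlam : 0 < lam) (hlam1 : lam ≤ 1)
    (hx : max (α * paretoGrowth lam α Γ - 1) 0 * (if (1 - lam) ^ (1 / lam) ≤ α then 1 else 0) < x) :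
    ∀ᶠ n : ℕ in atTop, ∀ μ ∈ lambdaRegular lam,
      ENNReal.ofReal Γ * optRevenue ⌈α * n⌉₊ n μ ≤ vcgRevenue ⌈α * n⌉₊ (n + ⌈x * n⌉₊) μ := by
  suffices h : ∃ κ D θ, CurveBound (paretoValue lam) κ D ∧ 0 < θ ∧ θ < 1 ∧
      0 < paretoValue lam θ ∧ Γ * (κ / α + D) < paretoValue lam θ ∧ 0 ≤ x ∧ α < (1 + x) * θ by
    obtain ⟨κ, D, θ, hW, hθ, hθ1, hWθ, hκ, hx0, hxθ⟩ := h
    filter_upwards [eventually_le_vcgRevenue hα hΓ hΓ1 hW hθ hθ1 hWθ hκ hx0 hxθ hα1] with n hn μ hμ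
    exact hn μ (isCurveRegular_of_lambdaRegular hμ
      (hasSupportingLines_of_lambdaRegular hlam hμ))
  split_ifs at hx with hc
  · rw [mul_one, max_lt_iff] at hx
    obtain ⟨hY, hval⟩ := paretoValue_inv_paretoGrowth hlam hlam1 hα hΓ
    set Y := paretoGrowth lam α Γ
    have hY0 : 0 < Y := zero_lt_one.trans hY
    have hlt : α / (1 + x) < 1 / Y := by
      rw [div_lt_div_iff₀ (by linarith) hY0]
      linarith
    -- Above `α / (1 + x)`, so demand at `v₁` exceeds supply; below the critical quantile, so `W θ >
    -- Γ K / α`.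
    obtain ⟨θ, hθl, hθu⟩ := exists_between hlt
    have hθ0 : 0 < θ := (div_pos hα (by linarith)).trans hθl
    have hWθ := paretoValue_strictAnti hlam hθ0 hθu
    rw [hval] at hWθ
    have hK := paretoRevenue_pos hlam1
    have hpos : 0 < Γ * paretoRevenue lam / α := by positivity
    refine ⟨paretoRevenue lam, 0, θ, ⟨paretoValue_one lam, hK.le, le_rfl, fun q hq _ => ?_⟩, hθ0,
      hθu.trans ((div_lt_one hY0).2 hY), hpos.trans hWθ, ?_, hx.2.le, ?_⟩
    · simpa using mul_paretoValue_le_paretoRevenue hlam hlam1 hq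
    · rwa [add_zero, ← mul_div_assoc]
    · rw [div_lt_iff₀ (by linarith)] at hθl
      linarith
  · rw [mul_zero] at hx
    rw [not_le] at hc
    have hlam1' : lam < 1 := lt_of_le_of_ne hlam1 (by
      rintro rfl
      simp at hc
      linarith)
    have h1 : 0 < 1 - lam := sub_pos.2 hlam1'
    have hαlam : α ^ lam ≤ 1 - lam := by
      have := Real.rpow_le_rpow hα.le hc.le hlam.le
      rwa [← Real.rpow_mul h1.le, one_div_mul_cancel hlam.ne', Real.rpow_one] at this
    have hα1' : α < 1 := hc.trans (Real.rpow_lt_one h1.le (by linarith) (by positivity))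
    have hWα : 0 < paretoValue lam α := by
      rw [← paretoValue_one lam]
      exact paretoValue_strictAnti hlam hα hα1'
    have hαp : 0 < α ^ lam := Real.rpow_pos_of_pos hα _
    -- The tangent at `α`, with `θ = α`. Its slope is nonnegative because `α` lies left of the
    -- monopoly quantile.
    refine ⟨α ^ (1 - lam), ((1 - lam) * α ^ (-lam) - 1) / lam, α,
      ⟨paretoValue_one lam, by positivity, ?_, fun q hq _ => mul_paretoValue_le hlam hlam1 hα hq⟩,
      hα, hα1', hWα, ?_, hx.le, by nlinarith⟩
    · refine div_nonneg ?_ hlam.le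
      rw [Real.rpow_neg hα.le, ← div_eq_mul_inv, sub_nonneg, le_div_iff₀ hαp]
      linarith
    · have e : α ^ (1 - lam) / α + ((1 - lam) * α ^ (-lam) - 1) / lam = paretoValue lam α := by
        rw [sub_eq_add_neg, Real.rpow_add hα, Real.rpow_one, paretoValue]
        field_simp
        ring
      rw [e]
      exact mul_lt_of_lt_one_left hWα hΓ1

lemma eventually_lt_of_pareto {C D : Set (Measure ℝ)} (hD : densityWithMonopolyPrice ⊆ D)
    {lam x : ℝ} (hα : 0 < α) (hα1 : α ≤ 1) (hΓ : 0 < Γ) (hlam : 0 < lam) (hlam1 : lam < 1)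
    (hC : lambdaRegular lam ⊆ C) (hx : 0 < x) (hc : (1 - lam) ^ (1 / lam) ≤ α)
    (hxK : α * paretoValue lam (α / (1 + x)) < Γ * paretoRevenue lam) :
    ∀ᶠ n : ℕ in atTop, ∀ k : ℕ, (∀ μ ∈ C ∩ D,
      ENNReal.ofReal Γ * optRevenue ⌈α * n⌉₊ n μ ≤ vcgRevenue ⌈α * n⌉₊ (n + k) μ) →
        (1 + x) * n < n + k := by
  obtain ⟨μ, hμ, hcurve, hac, htail⟩ := exists_pareto hlam
  obtain ⟨hW, hK⟩ := monopolyQuantile_mul hlam hlam1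
  have h1 : 0 < 1 - lam := sub_pos.2 hlam1
  have hWpos : 0 < paretoValue lam ((1 - lam) ^ (1 / lam)) := by rw [hW]; positivity
  set β := α / (1 + x) with hβ
  have hβ0 : 0 < β := by positivity
  refine eventually_lt_of_hasValueCurve hcurve hac (hC hμ) hD hα hα1 hΓ hc hWpos ?_ hK
    (fun q hq _ => mul_paretoValue_le_paretoRevenue hlam hlam1.le hq)
    (A := β ^ (1 - lam)) (B := ((1 - lam) * β ^ (-lam) - 1) / lam) (by positivity)
    (fun q hq _ => mul_paretoValue_le hlam hlam1.le hβ0 hq) ?_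
  · rw [htail _ hWpos.le, hW]
    have e : 1 + lam * (1 / (1 - lam)) = (1 - lam)⁻¹ := by field_simp; ring
    rw [e, Real.inv_rpow h1.le, Real.rpow_neg h1.le, inv_inv]
  -- Since `(1 + x) * β = α`, the VCG bound is `1 + x` times the tangent at its own contact point
  -- `β`.
  · have e : (1 + x) * β ^ (1 - lam) + α * (((1 - lam) * β ^ (-lam) - 1) / lam) =
        α * paretoValue lam β := by
      have hxβ : (1 + x) * β = α := by rw [hβ]; field_simp
      rw [sub_eq_add_neg 1 lam, Real.rpow_add hβ0, Real.rpow_one, paretoValue, ← mul_assoc, hxβ]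
      field_simp
      ring
    rwa [e]

lemma paretoValue_lt_of_lt_paretoGrowth {lam x : ℝ} (hα : 0 < α) (hΓ : 0 < Γ) (hlam : 0 < lam)
    (hlam1 : lam ≤ 1) (hx : 0 < x) (h : x < α * paretoGrowth lam α Γ - 1) :
    α * paretoValue lam (α / (1 + x)) < Γ * paretoRevenue lam := by
  obtain ⟨hY, hval⟩ := paretoValue_inv_paretoGrowth hlam hlam1 hα hΓ
  have hY0 : 0 < paretoGrowth lam α Γ := zero_lt_one.trans hY
  have hlt : 1 / paretoGrowth lam α Γ < α / (1 + x) := by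
    rw [div_lt_div_iff₀ hY0 (by linarith)]
    linarith
  have := paretoValue_strictAnti hlam (by positivity) hlt
  rwa [hval, lt_div_iff₀ hα, mul_comm] at this

/-- The lower bound at `lam = 1` is obtained from generalized Pareto distributions with `lam`
close to `1`. -/
lemma exists_lt_one_of_lt {x : ℝ} (hα : 0 < α) (hx : 0 < x) (h : x < Γ + α - 1) :
    ∃ lam, 0 < lam ∧ lam < 1 ∧ (1 - lam) ^ (1 / lam) ≤ α ∧
      α * paretoValue lam (α / (1 + x)) < Γ * paretoRevenue lam := by
  have hβ : 0 < α / (1 + x) := by positivity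
  -- Writing the Pareto revenue through `Real.negMulLog` gives continuity at `lam = 1`, where the
  -- power is `0 ^ 0`.
  set g : ℝ → ℝ := fun lam => Γ * Real.exp (-Real.negMulLog (1 - lam) / lam) -
    α * paretoValue lam (α / (1 + x)) with hg
  have hcont : ContinuousAt g 1 := by
    have c1 : ContinuousAt (fun lam : ℝ => -Real.negMulLog (1 - lam) / lam) 1 :=
      ContinuousAt.div (by fun_prop) continuousAt_id one_ne_zero
    have c2 : ContinuousAt (fun lam : ℝ => (α / (1 + x)) ^ (-lam)) 1 :=
      ContinuousAt.rpow continuousAt_const continuousAt_id.neg (Or.inl hβ.ne')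
    have c3 : ContinuousAt (fun lam : ℝ => paretoValue lam (α / (1 + x))) 1 :=
      ContinuousAt.div (c2.sub continuousAt_const) continuousAt_id one_ne_zero
    exact (continuousAt_const.mul c1.rexp).sub (continuousAt_const.mul c3)
  have hg1 : 0 < g 1 := by
    simp only [hg, paretoValue, Real.rpow_neg_one, sub_self, Real.negMulLog_zero]
    have : α * (((α / (1 + x))⁻¹ - 1) / 1) = 1 + x - α := by field_simp
    rw [this]
    simp
    linarith
  have hev : ∀ᶠ lam in 𝓝[<] (1 : ℝ), 0 < g lam :=
    (hcont.eventually (lt_mem_nhds hg1)).filter_mono nhdsWithin_le_nhds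
  -- For `lam > 1 - α` the monopoly quantile is at most `1 - lam`, hence at most `α`.
  have hev2 : ∀ᶠ lam in 𝓝[<] (1 : ℝ), max 0 (1 - α) < lam :=
    (lt_mem_nhds (max_lt one_pos (by linarith))).filter_mono nhdsWithin_le_nhds
  obtain ⟨lam, h1, h2, h3⟩ := (hev.and (hev2.and self_mem_nhdsWithin)).exists
  have h3 : lam < 1 := h3
  obtain ⟨hl0, hlα⟩ := max_lt_iff.1 h2
  have hp : 0 < 1 - lam := sub_pos.2 h3
  refine ⟨lam, hl0, h3, ?_, ?_⟩
  · refine (Real.rpow_le_rpow_of_exponent_ge hp (by linarith)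
      ((one_le_div hl0).2 h3.le)).trans ?_
    rw [Real.rpow_one]
    linarith
  · have e : paretoRevenue lam = Real.exp (-Real.negMulLog (1 - lam) / lam) := by
      rw [paretoRevenue, Real.rpow_def_of_pos hp, Real.negMulLog]
      congr 1
      ring
    rw [e]
    simp only [hg] at h1
    linarith

lemma paretoGrowth_one (hα : 0 < α) : α * paretoGrowth 1 α Γ - 1 = Γ + α - 1 := by
  simp only [paretoGrowth, paretoRevenue, sub_self, div_one, Real.rpow_zero, Real.rpow_one]
  field_simp

lemma hasAsymptoticCC_lambdaRegular {D : Set (Measure ℝ)} (hD : densityWithMonopolyPrice ⊆ D)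
    (hα : 0 < α) (hα1 : α ≤ 1) (hΓ : 0 < Γ) (hΓ1 : Γ < 1) {lam : ℝ} (hlam : 0 < lam)
    (hlam1 : lam ≤ 1) :
    HasAsymptoticCC α (lambdaRegular lam ∩ D) Γ (max (α * paretoGrowth lam α Γ - 1) 0 *
      (if (1 - lam) ^ (1 / lam) ≤ α then 1 else 0)) := by
  refine hasAsymptoticCC_of_bounds (mul_nonneg (le_max_right _ _) (by split_ifs <;> norm_num))
    (fun x hx => ?_) fun x hx0 hx => ?_
  · filter_upwards [eventually_le_of_lambdaRegular hα hα1 hΓ hΓ1 hlam hlam1 hx] with n hn μ hμ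
    exact hn μ hμ.1
  · split_ifs at hx with hc
    · rw [mul_one, lt_max_iff, or_iff_left hx0.not_gt] at hx
      rcases hlam1.lt_or_eq with h | rfl
      · exact eventually_lt_of_pareto hD hα hα1 hΓ hlam h subset_rfl hx0 hc
          (paretoValue_lt_of_lt_paretoGrowth hα hΓ hlam hlam1 hx0 hx)
      · rw [paretoGrowth_one hα] at hx
        obtain ⟨lam, hl0, hl1, hc', hlt⟩ := exists_lt_one_of_lt hα hx0 hx
        exact eventually_lt_of_pareto hD hα hα1 hΓ hl0 hl1 (lambdaRegular_mono hl1.le) hx0 hc' hlt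
    · rw [mul_zero] at hx
      exact absurd hx hx0.not_gt

/-- The same argument with `W q = -log q`, whose monopoly quantile and maximal revenue are both `1 /
e`. The critical quantile is `exp (-E)`. -/
lemma hasAsymptoticCC_lambdaRegular_zero {D : Set (Measure ℝ)}
    (hD : densityWithMonopolyPrice ⊆ D) (hα : 0 < α) (hα1 : α ≤ 1) (hΓ : 0 < Γ) (hΓ1 : Γ < 1) :
    HasAsymptoticCC α (lambdaRegular 0 ∩ D) Γ
      (max (α * Real.exp (Γ / (Real.exp 1 * α)) - 1) 0 *
        (if 1 / Real.exp 1 ≤ α then 1 else 0)) := by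
  set E := Γ / (Real.exp 1 * α) with hE
  have he : 0 < Real.exp 1 := Real.exp_pos 1
  have hE0 : 0 < E := by positivity
  have hinv : 0 < 1 / Real.exp 1 := by positivity
  have hloginv : Real.log (1 / Real.exp 1) = -1 := by simp
  have hmax : ∀ q, 0 < q → q ≤ 1 → q * -Real.log q ≤ 1 / Real.exp 1 := fun q hq _ => by
    have := mul_neg_log_le hinv hq
    rwa [hloginv, neg_neg, sub_self, zero_mul, add_zero] at this
  refine hasAsymptoticCC_of_bounds (mul_nonneg (le_max_right _ _) (by split_ifs <;> norm_num))
    (fun x hx => ?_) fun x hx0 hx => ?_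
  · suffices h : ∃ κ D θ, CurveBound (fun q => -Real.log q) κ D ∧ 0 < θ ∧ θ < 1 ∧
        0 < -Real.log θ ∧ Γ * (κ / α + D) < -Real.log θ ∧ 0 ≤ x ∧ α < (1 + x) * θ by
      obtain ⟨κ, D, θ, hW, hθ, hθ1, hWθ, hκ, hx0, hxθ⟩ := h
      filter_upwards [eventually_le_vcgRevenue hα hΓ hΓ1 hW hθ hθ1 hWθ hκ hx0 hxθ hα1]
        with n hn μ hμ
      exact hn μ (isCurveRegular_of_lambdaRegular hμ.1
        (hasSupportingLines_of_lambdaRegular_zero hμ.1))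
    split_ifs at hx with hc
    · rw [mul_one, max_lt_iff] at hx
      have hlt : α / (1 + x) < Real.exp (-E) := by
        rw [Real.exp_neg, ← one_div, div_lt_div_iff₀ (by linarith) (Real.exp_pos _)]
        linarith
      obtain ⟨θ, hθl, hθu⟩ := exists_between hlt
      have hθ0 : 0 < θ := (div_pos hα (by linarith)).trans hθl
      have hlog : E < -Real.log θ := by
        have := (Real.log_lt_iff_lt_exp hθ0).2 hθu
        linarith
      refine ⟨1 / Real.exp 1, 0, θ, ⟨by simp, hinv.le, le_rfl, fun q hq hq1 => ?_⟩, hθ0,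
        hθu.trans (by simpa using hE0), hE0.trans hlog, ?_, hx.2.le, ?_⟩
      · simpa using hmax q hq hq1
      · have e : Γ * (1 / Real.exp 1 / α + 0) = E := by rw [hE]; field_simp; ring
        rwa [e]
      · rw [div_lt_iff₀ (by linarith)] at hθl
        linarith
    · rw [mul_zero] at hx
      rw [not_le] at hc
      have hlogα : 1 < -Real.log α := by
        have := Real.log_lt_log hα hc
        rw [hloginv] at this
        linarith
      have hα1' : α < 1 := hc.trans ((div_lt_one he).2 (Real.one_lt_exp_iff.2 one_pos))
      refine ⟨α, -Real.log α - 1, α, ⟨by simp, hα.le, by linarith,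
        fun q hq _ => mul_neg_log_le hα hq⟩, hα, hα1', by linarith, ?_, hx.le, by nlinarith⟩
      rw [div_self hα.ne', add_sub_cancel]
      exact mul_lt_of_lt_one_left (by linarith) hΓ1
  · split_ifs at hx with hc
    · rw [mul_one, lt_max_iff, or_iff_left hx0.not_gt] at hx
      obtain ⟨μ, hμ, hcurve, hac, htail⟩ := exists_exponential
      set β := α / (1 + x) with hβ
      have hβ0 : 0 < β := by positivity
      refine eventually_lt_of_hasValueCurve hcurve hac hμ hD hα hα1 hΓ (q₀ := 1 / Real.exp 1)
        hc (by simp) ?_ (K := 1 / Real.exp 1) (by simp) hmax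
        (A := β) (B := -Real.log β - 1) hβ0.le (fun q hq _ => mul_neg_log_le hβ0 hq) ?_
      · rw [htail _ (by simp)]
        simp [Real.exp_neg]
      · have hxβ : (1 + x) * β = α := by rw [hβ]; field_simp
        have hlt : Real.exp (-E) < β := by
          rw [Real.exp_neg, ← one_div, hβ, div_lt_div_iff₀ (Real.exp_pos _) (by linarith)]
          linarith
        have hlog := (Real.lt_log_iff_exp_lt hβ0).2 hlt
        have e : Γ * (1 / Real.exp 1) = α * E := by rw [hE]; field_simp
        rw [hxβ, e]
        nlinarith
    · rw [mul_zero] at hx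
      exact absurd hx hx0.not_gt

end

end Auction

end

/-- Asymptotic competition complexity of the VCG auction. The class `D` only serves to make the
claim independent of side conditions: `D = Set.univ` allows an atom at the top of the support and
an unattained monopoly revenue, `D = Auction.densityWithMonopolyPrice` forbids both. -/
theorem theorem4p2 (α Γ : ℝ) (hα : 0 < α) (hα' : α ≤ 1) (hΓ : 0 < Γ) (hΓ' : Γ < 1)
    (D : Set (MeasureTheory.Measure ℝ)) (hD : Auction.densityWithMonopolyPrice ⊆ D) :
    (∀ lam : ℝ, 0 < lam → lam ≤ 1 →
      Auction.HasAsymptoticCC α (Auction.lambdaRegular lam ∩ D) Γ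
        (max (α * (lam * Γ / α * (1 - lam) ^ ((1 - lam) / lam) + 1) ^ (1 / lam) - 1) 0 *
          (if (1 - lam) ^ (1 / lam) ≤ α then 1 else 0))) ∧
    Auction.HasAsymptoticCC α (Auction.lambdaRegular 0 ∩ D) Γ
      (max (α * Real.exp (Γ / (Real.exp 1 * α)) - 1) 0 *
        (if 1 / Real.exp 1 ≤ α then 1 else 0)) ∧
    Auction.HasAsymptoticCC α (Auction.mhr ∩ D) Γ
      (max (α * Real.exp (Γ / (Real.exp 1 * α)) - 1) 0 *
        (if 1 / Real.exp 1 ≤ α then 1 else 0)) ∧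
    Auction.HasAsymptoticCC α (Auction.regular ∩ D) Γ (max (Γ + α - 1) 0) := by
  have h0 := Auction.hasAsymptoticCC_lambdaRegular_zero hD hα hα' hΓ hΓ'
  refine ⟨fun lam hlam hlam1 =>
    Auction.hasAsymptoticCC_lambdaRegular hD hα hα' hΓ hΓ' hlam hlam1, h0, ?_, ?_⟩
  · rw [Auction.mhr_eq_lambdaRegular_zero]
    exact h0
  -- At `lam = 1` the cutoff is `0 ^ 1 = 0 ≤ α`, so the indicator disappears.
  · have h1 := Auction.hasAsymptoticCC_lambdaRegular hD hα hα' hΓ hΓ' one_pos le_rfl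
    rw [Auction.paretoGrowth_one hα] at h1
    simpa [Auction.regular_eq_lambdaRegular_one, hα.le] using h1
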